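/- Let $\Bbbk$ be an algebraically closed field of characteristic zero, let $r,w\geq 1$, and let $\mathbb{G}_a^r\rtimes_w\mathbb{G}_m$ be the semi-direct product in which $t\in\mathbb{G}_m$ acts on $\mathbb{G}_a^r$ by $u\mapsto t^wu$. Put $\mathfrak{u}=\mathrm{Lie}(\mathbb{G}_a^r)$. A variety is an integral scheme, separated and of finite type over $\Bbbk$; points are $\Bbbk$-rational points. An affine cone with an action of $\mathbb{G}_a^r\rtimes_w\mathbb{G}_m$ is an affine morphism of varieties $\pi:C\to S$, together with an action of $\mathbb{G}_a^r\rtimes_w\mathbb{G}_m$ on $C$ for which $\pi$ is invariant, such that the $\mathbb{G}_m$-weights give a grading $\mathcal{A}:=\pi_*\mathcal{O}_C=\bigoplus_{n\geq0}\mathcal{A}_n$ with $\mathcal{A}_0=\mathcal{O}_S$ (where $f\in\mathcal{A}_n$ means $f(t.x)=t^nf(x)$). Its zero section is $Z:=\mathbb{V}(\mathcal{A}_{>0})\subseteq C$. For $x\in C$ let $\mathrm{Stab}_{\mathfrak{u}}(x)\subseteq\mathfrak{u}$ be the Lie algebra stabiliser, and put $d(\pi):=\min_{z\in Z}\dim\mathrm{Stab}_{\mathfrak{u}}(z)$.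 Let $\mathcal{Q}(\pi)$ be the cokernel of $\Omega_{\mathcal{A}/\mathcal{A}_0}\to\mathfrak{u}^*\otimes\mathcal{A}$, $\mathrm{d}f\mapsto\sum_iu_i\otimes\xi_i.f$, where $\xi_1,\dots,\xi_r$ and $u_1,\dots,u_r$ are dual bases of $\mathfrak{u}$ and $\mathfrak{u}^*$, and $\xi_i.f$ is the derivative of $f$ along the vector field of $\xi_i$. Let $Z^{\mathrm{reg}}:=\{z\in Z:\dim\mathrm{Stab}_{\mathfrak{u}}(z)=d(\pi)\}$. Give $Z\setminus Z^{\mathrm{reg}}$ the closed subscheme structure with ideal $\mathcal{I}:=\mathrm{Fit}_{d(\pi)}(\mathcal{Q}(\pi))+\mathcal{A}_{>0}$, and let $\overline{\mathbb{G}_a^r.(Z\setminus Z^{\mathrm{reg}})}\subseteq C$ be the scheme theoretic image of the action morphism $\mathbb{G}_a^r\times(Z\setminus Z^{\mathrm{reg}})\to C$, that is, the closed subscheme with ideal $\mathcal{J}:=\ker\big(\mathcal{A}\to\mathcal{O}(\mathbb{G}_a^r)\otimes\mathcal{A}/\mathcal{I}\big)$. The modification of $\pi:C\to S$ with centre a $\mathbb{G}_a^r\rtimes_w\mathbb{G}_m$-invariant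 closed subscheme $V$ is the affine cone $\pi':C'\to S'$ with an action of $\mathbb{G}_a^r\rtimes_w\mathbb{G}_m$, in a commutative square with $p:C'\to C$ and $q:S'\to S$, such that $C'\subseteq\mathrm{Bl}_V(C)$ is the open stratum of the Białynicki-Birula stratification of $\mathrm{Bl}_V(C)$ (the strata being the sets of points $x$ with $\lim_{t\to0}t.x$ in a given connected component of the fixed locus of $\mathbb{G}_m$), $p$ is the restriction of the blowing up, and the actions on $C'$ are those for which $p$ is equivariant. Let $\pi:C\to S$ be an affine cone with an action of $\mathbb{G}_a^r\rtimes_w\mathbb{G}_m$, and let $\pi':C'\to S'$ be its modification with centre $\overline{\mathbb{G}_a^r.(Z\setminus Z^{\mathrm{reg}})}$, with zero section $Z'\subseteq C'$. Then $\dim\mathrm{Stab}_{\mathfrak{u}}(z')=d(\pi)$ for every $z'\in Z'$. In particular $d(\pi')=d(\pi)$. -/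

import Mathlib

open CategoryTheory AlgebraicGeometry TopologicalSpace

universe u

noncomputable section

namespace AdditiveCone

/-! ### Schemes over a field and their points -/

/-- Schemes over `k`. -/
abbrev SchOver (k : Type u) [Field k] := Over (Spec (CommRingCat.of k))

section Points

variable (k : Type u) [Field k]

/-- The final `k`-scheme `Spec k`. -/
abbrev pt : SchOver k := Over.mk (𝟙 (Spec (CommRingCat.of k)))

variable {k}

/-- The structure morphism `T ⟶ Spec k`. -/
abbrev toPt (T : SchOver k) : T ⟶ pt k := Over.homMk T.hom

/-- The `k`-rational points of `X`. -/
abbrev KPoint (X : SchOver k) := pt k ⟶ X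

/-- The topological point underlying a `k`-rational point. -/
def KPoint.pos {X : SchOver k} (x : KPoint X) : X.left :=
  x.left (IsLocalRing.closedPoint k)

variable (k) in
/-- The spectrum of a `k`-algebra, as a `k`-scheme. -/
abbrev specOver (R : Type u) [CommRing R] [Algebra k R] : SchOver k :=
  Over.mk (Spec.map (CommRingCat.ofHom (algebraMap k R)))

/-- The morphism of spectra given by a homomorphism of `k`-algebras. -/
abbrev specOverMap {R R' : Type u} [CommRing R] [CommRing R'] [Algebra k R] [Algebra k R']
    (φ : R →ₐ[k] R') : specOver k R' ⟶ specOver k R :=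
  Over.homMk (Spec.map (CommRingCat.ofHom φ.toRingHom)) (by
    simp only [Over.mk_hom, ← Spec.map_comp, ← CommRingCat.ofHom_comp]
    congr 2
    exact φ.comp_algebraMap)

/-- The `k`-rational point of `Spec R` given by a homomorphism of `k`-algebras `R → k`. -/
abbrev specPoint {R : Type u} [CommRing R] [Algebra k R] (φ : R →ₐ[k] k) :
    KPoint (specOver k R) :=
  Over.homMk (Spec.map (CommRingCat.ofHom φ.toRingHom)) (by
    simp only [Over.mk_hom, ← Spec.map_comp, ← CommRingCat.ofHom_comp]
    rw [show φ.toRingHom.comp (algebraMap k R) = RingHom.id k from φ.comp_algebraMap]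
    exact Spec.map_id _)

/-- An element of `R` as a global function on `Spec R`. -/
abbrev specFun {R : CommRingCat.{u}} : R →+* Γ(Spec R, ⊤) := (Scheme.ΓSpecIso R).inv.hom

end Points

/-! ### Actions of `𝔾ₐ^r` and `𝔾ₘ`, through functors of points -/

section Actions

variable {k : Type u} [Field k]

/-- An action of `𝔾ₐ^r` on the `k`-scheme `X`: the groups `𝔾ₐ^r(T) = Γ(T, 𝒪_T)^r` act on the sets
`X(T)`, naturally in the `k`-scheme `T`. -/
structure GaAction (r : ℕ) (X : SchOver k) where
  act : ∀ {T : SchOver k}, (Fin r → Γ(T.left, ⊤)) → (T ⟶ X) → (T ⟶ X)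
  act_zero : ∀ {T : SchOver k} (x : T ⟶ X), act 0 x = x
  act_add : ∀ {T : SchOver k} (u v : Fin r → Γ(T.left, ⊤)) (x : T ⟶ X),
    act (u + v) x = act u (act v x)
  naturality : ∀ {T T' : SchOver k} (f : T' ⟶ T) (u : Fin r → Γ(T.left, ⊤)) (x : T ⟶ X),
    f ≫ act u x = act (fun i ↦ f.left.appTop.hom (u i)) (f ≫ x)

/-- An action of `𝔾ₘ` on the `k`-scheme `X`: the groups `𝔾ₘ(T) = Γ(T, 𝒪_T)ˣ` act on the sets
`X(T)`, naturally in the `k`-scheme `T`. -/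
structure GmAction (X : SchOver k) where
  act : ∀ {T : SchOver k}, (Γ(T.left, ⊤))ˣ → (T ⟶ X) → (T ⟶ X)
  act_one : ∀ {T : SchOver k} (x : T ⟶ X), act 1 x = x
  act_mul : ∀ {T : SchOver k} (s t : (Γ(T.left, ⊤))ˣ) (x : T ⟶ X),
    act (s * t) x = act s (act t x)
  naturality : ∀ {T T' : SchOver k} (f : T' ⟶ T) (t : (Γ(T.left, ⊤))ˣ) (x : T ⟶ X),
    f ≫ act t x = act (Units.map f.left.appTop.hom.toMonoidHom t) (f ≫ x)

/-- The actions of `𝔾ₐ^r` and `𝔾ₘ` constitute an action of `𝔾ₐ^r ⋊_w 𝔾ₘ`, where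
`t u t⁻¹ = t ^ w u`. -/
def IsSemidirect {r : ℕ} (w : ℕ) {X : SchOver k} (ga : GaAction r X) (gm : GmAction X) : Prop :=
  ∀ {T : SchOver k} (t : (Γ(T.left, ⊤))ˣ) (u : Fin r → Γ(T.left, ⊤)) (x : T ⟶ X),
    gm.act t (ga.act u x) = ga.act (fun i ↦ (t : Γ(T.left, ⊤)) ^ w * u i) (gm.act t x)

/-- The functions `f` of weight `n` on the open subset `V`: those with `f(t.x) = t ^ n f(x)`. -/
def GmAction.weight {X : SchOver k} (gm : GmAction X) (V : X.left.Opens) (n : ℕ) :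
    AddSubgroup Γ(X.left, V) where
  carrier := {f | ∀ (T : SchOver k) (t : (Γ(T.left, ⊤))ˣ) (x : T ⟶ X)
    (h : ⊤ ≤ x.left ⁻¹ᵁ V) (h' : ⊤ ≤ (gm.act t x).left ⁻¹ᵁ V),
    ((gm.act t x).left.appLE V ⊤ h').hom f =
      (t : Γ(T.left, ⊤)) ^ n * (x.left.appLE V ⊤ h).hom f}
  zero_mem' := by intro T t x h h'; simp
  add_mem' := by
    intro f g hf hg T t x h h'
    rw [map_add, map_add, hf T t x h h', hg T t x h h', mul_add]
  neg_mem' := by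
    intro f hf T t x h h'
    rw [map_neg, map_neg, hf T t x h h', mul_neg]

/-- The Lie algebra stabiliser `Stab_𝔲(x) ⊆ 𝔲 = Lie(𝔾ₐ^r) = k^r` of a `k`-rational point `x`: the
`ξ` such that `ε ξ ∈ 𝔾ₐ^r(k[ε])` fixes `x`, viewed as a `k[ε]`-point. -/
def GaAction.lieStab {r : ℕ} {X : SchOver k} (ga : GaAction r X) (x : KPoint X) :
    Submodule k (Fin r → k) where
  carrier := {ξ | ga.act (T := specOver k (DualNumber k))
    (fun i ↦ specFun (R := .of (DualNumber k)) (TrivSqZeroExt.inr (ξ i))) (toPt _ ≫ x) =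
      toPt _ ≫ x}
  zero_mem' := by
    have := ga.act_zero (T := specOver k (DualNumber k)) (toPt _ ≫ x)
    simp only [Set.mem_ofPred_eq, Pi.zero_apply, TrivSqZeroExt.inr_zero, map_zero]
    exact this
  add_mem' := by
    intro ξ η hξ hη
    simp only [Set.mem_ofPred_eq, Pi.add_apply, TrivSqZeroExt.inr_add, map_add] at hξ hη ⊢
    refine (ga.act_add (T := specOver k (DualNumber k)) _ _ _).trans ?_
    rw [hη, hξ]
  smul_mem' := by
    intro c ξ hξ
    simp only [Set.mem_ofPred_eq] at hξ ⊢
    let φ : DualNumber k →ₐ[k] DualNumber k := TrivSqZeroExt.map (c • LinearMap.id)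
    have h1 : specOverMap φ ≫ toPt (specOver k (DualNumber k)) = toPt _ := by
      ext1
      simpa using Over.w (specOverMap φ)
    have h2 := ga.naturality (specOverMap φ)
      (fun i ↦ specFun (R := .of (DualNumber k)) (TrivSqZeroExt.inr (ξ i))) (toPt _ ≫ x)
    rw [hξ, ← Category.assoc, h1] at h2
    refine Eq.trans ?_ h2.symm
    congr 1
    funext i
    have h3 := Scheme.ΓSpecIso_inv_naturality (CommRingCat.ofHom φ.toRingHom)
    have h4 := congr($(h3).hom (TrivSqZeroExt.inr (ξ i)))
    simp only [CommRingCat.hom_comp, RingHom.comp_apply] at h4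
    refine Eq.trans ?_ h4
    congr 1
    exact (TrivSqZeroExt.map_inr (R' := k) (c • (LinearMap.id : k →ₗ[k] k)) (ξ i)).symm

/-! ### Limits and the Białynicki-Birula stratification -/

/-- The coordinate function `t` on `𝔾ₘ = Spec k[t, t⁻¹]`, as a point of `𝔾ₘ` with values in
`𝔾ₘ`. -/
def unitT (k : Type u) [Field k] : (Γ((specOver k (LaurentPolynomial k)).left, ⊤))ˣ :=
  Units.map (specFun (R := .of (LaurentPolynomial k))).toMonoidHom
    ⟨LaurentPolynomial.T 1, LaurentPolynomial.T (-1),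
      by rw [← LaurentPolynomial.T_add]; simp, by rw [← LaurentPolynomial.T_add]; simp⟩

/-- `lim_{t → 0} t.x = y`: the orbit map `𝔾ₘ → X`, `t ↦ t.x`, extends to a morphism `𝔸¹ → X` with
value `y` at `0`. -/
def GmAction.HasLimit {X : SchOver k} (gm : GmAction X) (x y : KPoint X) : Prop :=
  ∃ l : specOver k (Polynomial k) ⟶ X,
    specOverMap Polynomial.toLaurentAlg ≫ l = gm.act (unitT k) (toPt _ ≫ x) ∧
    specPoint (Polynomial.aeval (0 : k)) ≫ l = y

/-- A `k`-rational point fixed by `𝔾ₘ`. -/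
def GmAction.IsFixed {X : SchOver k} (gm : GmAction X) (x : KPoint X) : Prop :=
  ∀ (T : SchOver k) (t : (Γ(T.left, ⊤))ˣ), gm.act t (toPt T ≫ x) = toPt T ≫ x

/-- The set of the `k`-rational points fixed by `𝔾ₘ`. -/
def GmAction.fixedPoints {X : SchOver k} (gm : GmAction X) : Set X.left :=
  {p | ∃ x : KPoint X, gm.IsFixed x ∧ x.pos = p}

/-- `W` is an open stratum of the Białynicki-Birula stratification: `W` is open, and there is a
connected component `F` of the fixed locus such that the `k`-rational points of `W` are the `x`
for which `lim_{t → 0} t.x` exists and lies in `F`. -/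
def GmAction.IsOpenStratum {X : SchOver k} (gm : GmAction X) (W : Set X.left) : Prop :=
  IsOpen W ∧ ∃ p ∈ gm.fixedPoints, ∀ x : KPoint X,
    x.pos ∈ W ↔ ∃ y : KPoint X, y.pos ∈ connectedComponentIn gm.fixedPoints p ∧ gm.HasLimit x y

end Actions

/-! ### Affine cones with an action of `𝔾ₐ^r ⋊_w 𝔾ₘ` -/

/-- A variety over `k`: an integral (in particular non-empty) scheme, separated and of finite type
over `k`. -/
structure IsVariety {k : Type u} [Field k] (X : SchOver k) : Prop where
  isIntegral : IsIntegral X.left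
  isSeparated : IsSeparated X.hom
  locallyOfFiniteType : LocallyOfFiniteType X.hom
  quasiCompact : QuasiCompact X.hom

/-- An affine cone of varieties `π : C ⟶ S` with an action of `𝔾ₐ^r ⋊_w 𝔾ₘ` for which `π` is
invariant. The grading `π_* 𝒪_C = ⨁ 𝒜ₙ` with `𝒜₀ = 𝒪_S` is the one by the weights of `𝔾ₘ`. -/
structure Cone (k : Type u) [Field k] (r w : ℕ) where
  C : SchOver k
  S : SchOver k
  π : C ⟶ S
  isVariety_C : IsVariety C
  isVariety_S : IsVariety S
  isAffineHom : IsAffineHom π.left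
  ga : GaAction r C
  gm : GmAction C
  semidirect : IsSemidirect w ga gm
  ga_invariant : ∀ {T : SchOver k} (u : Fin r → Γ(T.left, ⊤)) (x : T ⟶ C), ga.act u x ≫ π = x ≫ π
  gm_invariant : ∀ {T : SchOver k} (t : (Γ(T.left, ⊤))ˣ) (x : T ⟶ C), gm.act t x ≫ π = x ≫ π
  isInternal : ∀ U : S.left.affineOpens,
    DirectSum.IsInternal fun n : ℕ ↦ gm.weight (π.left ⁻¹ᵁ U) n
  app_injective : ∀ U : S.left.affineOpens, Function.Injective (π.left.app U).hom
  weight_zero : ∀ U : S.left.affineOpens,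
    gm.weight (π.left ⁻¹ᵁ U) 0 = (π.left.app U).hom.range.toAddSubgroup

namespace Cone

variable {k : Type u} [Field k] {r w : ℕ} (X : Cone k r w)

/-- The algebra `𝒜(U) = Γ(π⁻¹ U, 𝒪_C)`. -/
abbrev alg (U : X.S.left.affineOpens) : CommRingCat.{u} := Γ(X.C.left, X.π.left ⁻¹ᵁ U)

/-- The ideal `𝒜_{>0}(U)`. -/
def posIdeal (U : X.S.left.affineOpens) : Ideal (X.alg U) :=
  Ideal.span {f | ∃ n : ℕ, 0 < n ∧ f ∈ X.gm.weight (X.π.left ⁻¹ᵁ U) n}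

/-- The `k`-rational points of the zero section `Z`, the closed subscheme cut out by `𝒜_{>0}`. -/
def zeroSection : Set (KPoint X.C) :=
  {z | ∀ (U : X.S.left.affineOpens) (h : ⊤ ≤ z.left ⁻¹ᵁ (X.π.left ⁻¹ᵁ U)),
    ∀ f ∈ X.posIdeal U, (z.left.appLE _ ⊤ h).hom f = 0}

/-- `dim Stab_𝔲(x)`. -/
def dimStab (x : KPoint X.C) : ℕ := Module.finrank k (X.ga.lieStab x)

/-- `d(π)`, the minimum of `dim Stab_𝔲(z)` over the points `z` of the zero section. -/
def d : ℕ := sInf (X.dimStab '' X.zeroSection)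

/-! ### The co-action and the module `𝒬(π)` -/

lemma isAffineOpen_preimage (U : X.S.left.affineOpens) : IsAffineOpen (X.π.left ⁻¹ᵁ U) :=
  haveI := X.isAffineHom
  U.2.preimage X.π.left

/-- The projection `𝔾ₐ^r × π⁻¹ U → π⁻¹ U ⊆ C`, where `𝔾ₐ^r × π⁻¹ U = Spec 𝒜(U)[u₁, …, u_r]`. -/
def proj (U : X.S.left.affineOpens) :
    Spec (.of (MvPolynomial (Fin r) (X.alg U))) ⟶ X.C.left :=
  Spec.map (CommRingCat.ofHom MvPolynomial.C) ≫ (X.isAffineOpen_preimage U).fromSpec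

/-- The `k`-scheme `𝔾ₐ^r × π⁻¹ U`. -/
abbrev prodOver (U : X.S.left.affineOpens) : SchOver k := Over.mk (X.proj U ≫ X.C.hom)

/-- The projection `𝔾ₐ^r × π⁻¹ U → C` over `k`. -/
abbrev projOver (U : X.S.left.affineOpens) : X.prodOver U ⟶ X.C := Over.homMk (X.proj U)

/-- The action morphism `𝔾ₐ^r × π⁻¹ U → C`, `(u, x) ↦ u.x`. -/
def action (U : X.S.left.affineOpens) : X.prodOver U ⟶ X.C :=
  X.ga.act (T := X.prodOver U)
    (fun i ↦ specFun (R := .of (MvPolynomial (Fin r) (X.alg U))) (MvPolynomial.X i))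
    (X.projOver U)

lemma top_le_action (U : X.S.left.affineOpens) :
    ⊤ ≤ (X.action U).left ⁻¹ᵁ (X.π.left ⁻¹ᵁ U) := by
  have h : (X.action U).left ≫ X.π.left = X.proj U ≫ X.π.left := by
    have := X.ga_invariant (T := X.prodOver U)
      (fun i ↦ specFun (R := .of (MvPolynomial (Fin r) (X.alg U))) (MvPolynomial.X i))
      (X.projOver U)
    exact congr($(this).left)
  rw [← Scheme.Hom.comp_preimage, h]
  intro p _
  simp [proj]

/-- The co-action `𝒜(U) → 𝒜(U)[u₁, …, u_r] = 𝒪(𝔾ₐ^r) ⊗ 𝒜(U)`. -/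
def coaction (U : X.S.left.affineOpens) : X.alg U →+* MvPolynomial (Fin r) (X.alg U) :=
  ((X.action U).left.appLE (X.π.left ⁻¹ᵁ U) ⊤ (X.top_le_action U) ≫
    (Scheme.ΓSpecIso (.of (MvPolynomial (Fin r) (X.alg U)))).hom).hom

lemma constantCoeff_coaction (U : X.S.left.affineOpens) (f : X.alg U) :
    MvPolynomial.constantCoeff (X.coaction U f) = f := by
  have hV := X.isAffineOpen_preimage U
  let e : MvPolynomial (Fin r) (X.alg U) →+* X.alg U := MvPolynomial.constantCoeff
  let s : Spec (X.alg U) ⟶ Spec (.of (MvPolynomial (Fin r) (X.alg U))) :=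
    Spec.map (CommRingCat.ofHom e)
  have hs : s ≫ X.proj U = hV.fromSpec := by
    rw [proj, ← Category.assoc, ← Spec.map_comp, ← CommRingCat.ofHom_comp,
      show e.comp MvPolynomial.C = RingHom.id _ from RingHom.ext fun a ↦ by simp [e]]
    exact (congr_arg (· ≫ _) (Spec.map_id (X.alg U))).trans (Category.id_comp _)
  let s' : Over.mk (hV.fromSpec ≫ X.C.hom) ⟶ X.prodOver U :=
    Over.homMk s (by simp only [Over.mk_hom, ← hs, Category.assoc])
  have h1 : s' ≫ X.action U = s' ≫ X.projOver U := by
    rw [action, X.ga.naturality]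
    convert! X.ga.act_zero (s' ≫ X.projOver U) using 2
    funext i
    have h3 := Scheme.ΓSpecIso_inv_naturality (CommRingCat.ofHom e)
    have h4 := congr($(h3).hom (MvPolynomial.X i))
    simp only [CommRingCat.hom_comp, RingHom.comp_apply] at h4
    refine h4.symm.trans ?_
    simp [e]
  have h2 : s ≫ (X.action U).left = hV.fromSpec := by
    rw [← hs]
    exact congr($(h1).left)
  have h5 : (X.action U).left.appLE (X.π.left ⁻¹ᵁ U) ⊤ (X.top_le_action U) ≫ s.appTop =
      (Scheme.ΓSpecIso _).inv := by
    have h6 : ∀ (g : Spec (X.alg U) ⟶ X.C.left) (_ : g = hV.fromSpec)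
        (hg : ⊤ ≤ g ⁻¹ᵁ (X.π.left ⁻¹ᵁ U)), g.appLE _ ⊤ hg = (Scheme.ΓSpecIso _).inv := by
      rintro g rfl hg
      rw [Scheme.Hom.appLE, hV.fromSpec_app_self, Category.assoc, ← Functor.map_comp]
      exact (congr_arg _ (CategoryTheory.Functor.map_id _ _)).trans (Category.comp_id _)
    rw [← h6 _ h2 (fun p _ ↦ X.top_le_action U (Set.mem_univ (s p))),
      ← Scheme.Hom.appLE_comp_appLE s (X.action U).left (X.π.left ⁻¹ᵁ U) ⊤ ⊤
        (X.top_le_action U) le_rfl]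
    exact congr_arg _ (Scheme.Hom.app_eq_appLE s)
  have h7 : (Scheme.ΓSpecIso (.of (MvPolynomial (Fin r) (X.alg U)))).hom ≫
      CommRingCat.ofHom e = s.appTop ≫ (Scheme.ΓSpecIso (X.alg U)).hom :=
    (Scheme.ΓSpecIso_naturality (CommRingCat.ofHom e)).symm
  have h8 : ((X.action U).left.appLE (X.π.left ⁻¹ᵁ U) ⊤ (X.top_le_action U) ≫
      (Scheme.ΓSpecIso (.of (MvPolynomial (Fin r) (X.alg U)))).hom) ≫ CommRingCat.ofHom e =
        𝟙 _ := by
    rw [Category.assoc, h7, ← Category.assoc, h5, Iso.inv_hom_id]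
  exact congr($(h8).hom f)

lemma coaction_app (U : X.S.left.affineOpens) (a : Γ(X.S.left, U)) :
    X.coaction U ((X.π.left.app U).hom a) = MvPolynomial.C ((X.π.left.app U).hom a) := by
  have hV := X.isAffineOpen_preimage U
  have h6 : ∀ (g : X.prodOver U ⟶ X.C) (_ : g.left ≫ X.π.left = X.proj U ≫ X.π.left)
      (hg : ⊤ ≤ g.left ⁻¹ᵁ (X.π.left ⁻¹ᵁ U)) (hg' : ⊤ ≤ X.proj U ⁻¹ᵁ (X.π.left ⁻¹ᵁ U)),
      X.π.left.app U ≫ g.left.appLE _ ⊤ hg = X.π.left.app U ≫ (X.proj U).appLE _ ⊤ hg' := by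
    intro g h hg hg'
    rw [Scheme.Hom.app_eq_appLE, Scheme.Hom.appLE_comp_appLE, Scheme.Hom.appLE_comp_appLE]
    simp only [h]
  have h7 : X.π.left.app U ≫ (X.action U).left.appLE _ ⊤ (X.top_le_action U) =
      X.π.left.app U ≫ (X.proj U).appLE _ ⊤ (by intro p _; simp [proj]) := by
    apply h6
    have := X.ga_invariant (T := X.prodOver U)
      (fun i ↦ specFun (R := .of (MvPolynomial (Fin r) (X.alg U))) (MvPolynomial.X i))
      (X.projOver U)
    exact congr($(this).left)
  have h8 : (X.proj U).appLE (X.π.left ⁻¹ᵁ U) ⊤ (by intro p _; simp [proj]) ≫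
      (Scheme.ΓSpecIso (.of (MvPolynomial (Fin r) (X.alg U)))).hom =
        CommRingCat.ofHom MvPolynomial.C := by
    have h9 : hV.fromSpec.appLE (X.π.left ⁻¹ᵁ U) ⊤ hV.fromSpec_preimage_self.ge =
        (Scheme.ΓSpecIso _).inv := by
      rw [Scheme.Hom.appLE, hV.fromSpec_app_self, Category.assoc, ← Functor.map_comp]
      exact (congr_arg _ (CategoryTheory.Functor.map_id _ _)).trans (Category.comp_id _)
    have h10 := Scheme.Hom.appLE_comp_appLE
      (Spec.map (CommRingCat.ofHom (MvPolynomial.C (σ := Fin r) (R := X.alg U))))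
      hV.fromSpec (X.π.left ⁻¹ᵁ U) ⊤ ⊤ hV.fromSpec_preimage_self.ge le_rfl
    rw [h9] at h10
    refine (congr_arg (· ≫ _) h10.symm).trans ?_
    have h11 := Scheme.ΓSpecIso_naturality
      (CommRingCat.ofHom (MvPolynomial.C (σ := Fin r) (R := X.alg U)))
    rw [Category.assoc, Iso.inv_comp_eq]
    refine Eq.trans ?_ h11
    exact congr_arg (· ≫ _) (Scheme.Hom.app_eq_appLE _).symm
  have h12 := congr($(h7) ≫ (Scheme.ΓSpecIso (.of (MvPolynomial (Fin r) (X.alg U)))).hom)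
  rw [Category.assoc, Category.assoc, h8] at h12
  exact congr($(h12).hom a)

/-- `𝒜(U)` is an algebra over `𝒜₀(U) = Γ(U, 𝒪_S)`. -/
instance algebraAlg (U : X.S.left.affineOpens) : Algebra Γ(X.S.left, U) (X.alg U) :=
  (X.π.left.app U).hom.toAlgebra

/-- The vector field of the `i`-th basis vector `ξᵢ` of `𝔲`: the composition of the co-action,
of `∂ / ∂uᵢ`, and of `u₁ = ⋯ = u_r = 0`. -/
def vectorField (U : X.S.left.affineOpens) (i : Fin r) :
    Derivation Γ(X.S.left, U) (X.alg U) (X.alg U) :=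
  Derivation.mk'
    { toFun := fun f ↦ MvPolynomial.constantCoeff (MvPolynomial.pderiv i (X.coaction U f))
      map_add' := fun f g ↦ by simp only [map_add]
      map_smul' := fun a f ↦ by
        rw [Algebra.smul_def, map_mul, RingHom.algebraMap_toAlgebra, coaction_app,
          Derivation.leibniz, MvPolynomial.pderiv_C]
        simp [Algebra.smul_def, RingHom.algebraMap_toAlgebra] }
    (fun f g ↦ by
      simp only [LinearMap.coe_mk, AddHom.coe_mk, map_mul, Derivation.leibniz, map_add,
        smul_eq_mul, constantCoeff_coaction])

/-- The morphism `Ω_{𝒜/𝒜₀} → 𝔲^* ⊗ 𝒜 = 𝒜^r` over `U`, sending `df` to `(ξ₁.f, …, ξ_r.f)`. -/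
def conormalMap (U : X.S.left.affineOpens) :
    Ω[X.alg U⁄Γ(X.S.left, U)] →ₗ[X.alg U] (Fin r → X.alg U) :=
  LinearMap.pi fun i ↦ (X.vectorField U i).liftKaehlerDifferential

/-- The module `𝒬(π)` over `U`, the cokernel of `Ω_{𝒜/𝒜₀} → 𝔲^* ⊗ 𝒜`. -/
abbrev Q (U : X.S.left.affineOpens) : Type u :=
  (Fin r → X.alg U) ⧸ LinearMap.range (X.conormalMap U)

end Cone

/-- The `d`-th Fitting ideal of a finitely generated module `M`, computed from a surjection
`φ : R ^ n → M`: it is generated by the minors of size `n - d` of the relations. (For `d ≥ n` it is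
the unit ideal, generated by the empty determinant.) -/
def fittingIdeal {R M : Type*} [CommRing R] [AddCommGroup M] [Module R M] {n : ℕ}
    (φ : (Fin n → R) →ₗ[R] M) (d : ℕ) : Ideal R :=
  Ideal.span {a | ∃ (v : Fin (n - d) → LinearMap.ker φ) (s : Fin (n - d) → Fin n),
    a = (Matrix.of fun i j ↦ (v i : Fin n → R) (s j)).det}

/-! ### The centre of the modification -/

namespace Cone

variable {k : Type u} [Field k] {r w : ℕ} (X : Cone k r w)

/-- The Fitting ideal `Fit_d(𝒬(π))` over `U`. -/
def fit (U : X.S.left.affineOpens) (d : ℕ) : Ideal (X.alg U) :=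
  fittingIdeal (LinearMap.range (X.conormalMap U)).mkQ d

/-- The ideal `ℐ = Fit_{d(π)}(𝒬(π)) + 𝒜_{>0}` of the closed subscheme `Z ∖ Z^reg` of `C`, where
`Z^reg` is the locus where `dim Stab_𝔲 = d(π)`. -/
def singIdeal (U : X.S.left.affineOpens) : Ideal (X.alg U) :=
  X.fit U X.d ⊔ X.posIdeal U

/-- The ideal `𝒥 = ker(𝒜 → 𝒪(𝔾ₐ^r) ⊗ 𝒜/ℐ)` of the closure of `𝔾ₐ^r.(Z ∖ Z^reg)`, the scheme
theoretic image of `𝔾ₐ^r × (Z ∖ Z^reg) → C`. -/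
def centreIdeal (U : X.S.left.affineOpens) : Ideal (X.alg U) :=
  RingHom.ker ((MvPolynomial.map (Ideal.Quotient.mk (X.singIdeal U))).comp (X.coaction U))

/-! ### Blowing up and modifications -/

/-- The inverse image ideal `f⁻¹ 𝒥 · 𝒪_Y` of a quasi-coherent ideal `𝒥` of `𝒜 = π_* 𝒪_C` is
invertible: locally it is generated by one function that is not a zero divisor. -/
def InverseImageInvertible (J : ∀ U : X.S.left.affineOpens, Ideal (X.alg U)) {Y : Scheme.{u}}
    (f : Y ⟶ X.C.left) : Prop :=
  ∀ y : Y, ∃ (U : X.S.left.affineOpens) (V : Y.affineOpens)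
    (h : V.1 ≤ f ⁻¹ᵁ (X.π.left ⁻¹ᵁ U)), y ∈ V.1 ∧
    ∃ g ∈ nonZeroDivisors Γ(Y, V), (J U).map (f.appLE _ V h).hom = Ideal.span {g}

/-- `b : B ⟶ C` is the blowing up of `C` in the closed subscheme cut out by `𝒥`, by the universal
property: `b` is final among the morphisms along which the inverse image of `𝒥` is invertible. -/
def IsBlowup (J : ∀ U : X.S.left.affineOpens, Ideal (X.alg U)) {B : Scheme.{u}}
    (b : B ⟶ X.C.left) : Prop :=
  X.InverseImageInvertible J b ∧
  ∀ (Y : Scheme.{u}) (f : Y ⟶ X.C.left), X.InverseImageInvertible J f → ∃! g : Y ⟶ B, g ≫ b = f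

/-- `X'`, that is `π' : C' ⟶ S'`, is the modification of `X`, that is of `π : C ⟶ S`, whose centre
is cut out by `𝒥`: there are
* the blowing up `b : B ⟶ C` with the action of `𝔾ₘ` on `B` for which `b` is equivariant,
* a `𝔾ₘ`-equivariant open immersion `j : C' ⟶ B` onto the open stratum of the Białynicki-Birula
  stratification of `B`, such that `p = b ∘ j` is `𝔾ₐ^r`-equivariant,
* and `q : S' ⟶ S` with `q ∘ π' = π ∘ p`. -/
def IsModification (J : ∀ U : X.S.left.affineOpens, Ideal (X.alg U)) (X' : Cone k r w) : Prop :=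
  ∃ (B : SchOver k) (b : B ⟶ X.C) (gmB : GmAction B) (j : X'.C ⟶ B) (q : X'.S ⟶ X.S),
    X.IsBlowup J b.left ∧
    (∀ {T : SchOver k} (t : (Γ(T.left, ⊤))ˣ) (x : T ⟶ B),
      gmB.act t x ≫ b = X.gm.act t (x ≫ b)) ∧
    IsOpenImmersion j.left ∧
    gmB.IsOpenStratum (Set.range j.left) ∧
    (∀ {T : SchOver k} (t : (Γ(T.left, ⊤))ˣ) (x : T ⟶ X'.C),
      X'.gm.act t x ≫ j = gmB.act t (x ≫ j)) ∧
    (∀ {T : SchOver k} (u : Fin r → Γ(T.left, ⊤)) (x : T ⟶ X'.C),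
      X'.ga.act u x ≫ j ≫ b = X.ga.act u (x ≫ j ≫ b)) ∧
    X'.π ≫ q = (j ≫ b) ≫ X.π

end Cone

end AdditiveCone

end

/-!
At a point `z'` of `Z'` the pulled back ideal `𝒥` is principal. As `z'` is fixed by `𝔾ₘ`, `𝒥` is
generated there by a function of degree `0`, hence by a single minor `δ = det (ξ_{s j}.hᵢ)` of size
`r - d(π)` with all `hᵢ` of weight `w`. Cramer's rule produces `g_a ∈ 𝒥` of weight `w` with
`ξ_{s b}.g_a = δ` if `a = b` and `0` otherwise. The quotients `g_a / δ` are functions on `C'` near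
`z'` with invertible Jacobian matrix, so that `dim Stab(z') ≤ d(π)`. Conversely, stabilisers do not
shrink under the blowing up away from the centre, and semicontinuity of `dim Stab` along `Z'` gives
`dim Stab(z') ≥ d(π)`.
-/

noncomputable section

namespace AdditiveCone

/-! ### Linear algebra -/

section LinearAlgebra

variable {ι κ k : Type*} [Field k]

lemma finrank_orthogonal_dotProductBilin [Fintype ι] (V : Submodule k (ι → k)) :
    Module.finrank k (LinearMap.BilinForm.orthogonal (dotProductBilin k k) V) =
      Fintype.card ι - Module.finrank k V := by
  have hrefl : (dotProductBilin k k : LinearMap.BilinForm k (ι → k)).IsRefl := fun v v' h ↦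
    (dotProduct_comm v' v).trans h
  rw [LinearMap.BilinForm.finrank_orthogonal, Module.finrank_fintype_fun_eq_card]
  exact hrefl.nondegenerate_iff_separatingLeft.2 fun v hv ↦ dotProduct_eq_zero_iff.1 hv

lemma mem_orthogonal_span_dotProductBilin [Fintype ι] {V : Set (ι → k)} {ξ : ι → k} :
    ξ ∈ LinearMap.BilinForm.orthogonal (dotProductBilin k k) (Submodule.span k V) ↔
      ∀ v ∈ V, v ⬝ᵥ ξ = 0 :=
  Submodule.span_le (p := LinearMap.ker ((dotProductBilin k k).flip ξ))

lemma linearIndependent_iff_exists_det_ne_zero [Finite ι] [Fintype κ] [DecidableEq κ]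
    {v : κ → ι → k} :
    LinearIndependent k v ↔ ∃ s : κ → ι, (Matrix.of fun i j ↦ v i (s j)).det ≠ 0 := by
  simp_rw [← isUnit_iff_ne_zero, ← Matrix.isUnit_iff_isUnit_det]
  constructor
  · intro hv
    have := Fintype.ofFinite ι
    let M : Matrix κ ι k := Matrix.of v
    obtain ⟨g, hg, -, hgli⟩ := Submodule.exists_fun_fin_finrank_span_eq k (Set.range M.col)
    choose s hs using hg
    have hcard : Fintype.card κ = Module.finrank k (Submodule.span k (Set.range M.col)) := by
      rw [← M.rank_eq_finrank_span_cols, LinearIndependent.rank_matrix (M := M) hv]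
    let e : κ ≃ Fin (Module.finrank k (Submodule.span k (Set.range M.col))) :=
      Fintype.equivFinOfCardEq hcard
    refine ⟨s ∘ e, Matrix.linearIndependent_cols_iff_isUnit.1 ?_⟩
    convert! hgli.comp e e.injective using 1
    exact funext fun i ↦ hs (e i)
  · rintro ⟨s, hs⟩
    exact (Matrix.linearIndependent_rows_iff_isUnit.2 hs).of_comp (LinearMap.funLeft k k s)

lemma le_finrank_span_iff_exists_det_ne_zero [Finite ι] {V : Set (ι → k)} {n : ℕ} :
    n ≤ Module.finrank k (Submodule.span k V) ↔
      ∃ v : Fin n → ι → k, (∀ i, v i ∈ V) ∧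
        ∃ s : Fin n → ι, (Matrix.of fun i j ↦ v i (s j)).det ≠ 0 := by
  simp_rw [← linearIndependent_iff_exists_det_ne_zero]
  constructor
  · intro hn
    obtain ⟨f, hfV, -, hf⟩ := Submodule.exists_fun_fin_finrank_span_eq k V
    exact ⟨f ∘ Fin.castLE hn, fun i ↦ hfV _, hf.comp _ (Fin.castLE_injective hn)⟩
  · rintro ⟨v, hvV, hv⟩
    rw [← Fintype.card_fin n, ← finrank_span_eq_card hv]
    exact Submodule.finrank_mono (Submodule.span_mono (Set.range_subset_iff.2 hvV))

end LinearAlgebra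

section Subring

variable {A n : Type*} [CommRing A] [Fintype n] [DecidableEq n] {S : Subring A} {M : Matrix n n A}

lemma det_mem_subring (hM : ∀ i j, M i j ∈ S) : M.det ∈ S := by
  let N : Matrix n n S := Matrix.of fun i j ↦ ⟨M i j, hM i j⟩
  have hN : M = S.subtype.mapMatrix N := rfl
  rw [hN, ← RingHom.map_det]
  exact N.det.2

lemma adjugate_mem_subring (hM : ∀ i j, M i j ∈ S) (i j : n) : M.adjugate i j ∈ S := by
  let N : Matrix n n S := Matrix.of fun i j ↦ ⟨M i j, hM i j⟩
  have hN : M = S.subtype.mapMatrix N := rfl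
  rw [hN, ← RingHom.map_adjugate]
  exact (N.adjugate i j).2

lemma derivation_adjugate_mulVec {R : Type*} [CommRing R] [Algebra R A] (D : Derivation R A A)
    (hM : ∀ i j, D (M.adjugate i j) = 0) (h : n → A) (a : n) :
    D ((M.adjugate.mulVec h) a) = (M.updateCol a fun i ↦ D (h i)).det := by
  rw [← Matrix.cramer_apply, Matrix.cramer_eq_adjugate_mulVec]
  simp [Matrix.mulVec, dotProduct, map_sum, Derivation.leibniz, hM]

end Subring

/-! ### Local rings and graded rings -/

section Nakayama

variable {R : Type*} [CommRing R] [IsDomain R]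

lemma exists_dvd_of_span_eq_span_singleton [IsLocalRing R] {s : Set R} {g : R} (hg : g ≠ 0)
    (h : Ideal.span s = Ideal.span {g}) : ∃ f ∈ s, f ≠ 0 ∧ ∀ a ∈ s, f ∣ a := by
  have hdvd : ∀ a ∈ s, g ∣ a := fun a ha ↦
    Ideal.mem_span_singleton.1 (h ▸ Ideal.subset_span ha)
  suffices ∃ c : R, IsUnit c ∧ g * c ∈ s by
    obtain ⟨c, hc, hcs⟩ := this
    exact ⟨g * c, hcs, mul_ne_zero hg hc.ne_zero, fun a ha ↦ hc.mul_right_dvd.2 (hdvd a ha)⟩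
  by_contra! hcon
  have hle : Ideal.span s ≤ IsLocalRing.maximalIdeal R * Ideal.span {g} := by
    refine Ideal.span_le.2 fun a ha ↦ ?_
    obtain ⟨c, rfl⟩ := hdvd a ha
    exact Ideal.mem_mul_span_singleton.2
      ⟨c, (IsLocalRing.mem_maximalIdeal c).2 fun hc ↦ hcon c hc ha, mul_comm c g⟩
  obtain ⟨m, hm, he⟩ := Ideal.mem_mul_span_singleton.1
    (hle (h ▸ Ideal.mem_span_singleton_self g))
  exact (IsLocalRing.mem_maximalIdeal m).1 hm
    (mul_right_cancel₀ hg (he.trans (one_mul g).symm) ▸ isUnit_one)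

lemma algebraMap_dvd_algebraMap_iff {p : Ideal R} [p.IsPrime] {L : Type*} [CommRing L]
    [Algebra R L] [IsLocalization.AtPrime L p] {x y : R} :
    algebraMap R L x ∣ algebraMap R L y ↔ ∃ s ∉ p, x ∣ s * y := by
  have hinj := IsLocalization.injective L p.primeCompl_le_nonZeroDivisors
  constructor
  · rintro ⟨c, hc⟩
    obtain ⟨⟨c', s⟩, hs : c * algebraMap R L s = algebraMap R L c'⟩ :=
      IsLocalization.surj p.primeCompl c
    refine ⟨s, s.2, c', hinj ?_⟩
    rw [map_mul, map_mul, hc, ← hs]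
    ring
  · rintro ⟨s, hs, h⟩
    have hu : IsUnit (algebraMap R L s) := IsLocalization.map_units L (⟨s, hs⟩ : p.primeCompl)
    rw [← hu.dvd_mul_left, ← map_mul]
    exact map_dvd _ h

end Nakayama

section GradedRing

variable {A : Type*} [CommRing A] (𝒜 : ℕ → AddSubgroup A) [GradedRing 𝒜]

lemma proj_mem (n : ℕ) (a : A) : GradedRing.proj 𝒜 n a ∈ 𝒜 n := SetLike.coe_mem _

lemma proj_of_mem {n : ℕ} {a : A} (ha : a ∈ 𝒜 n) : GradedRing.proj 𝒜 n a = a :=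
  DirectSum.decompose_of_mem_same _ ha

lemma proj_of_mem_of_ne {m n : ℕ} {a : A} (ha : a ∈ 𝒜 m) (h : m ≠ n) :
    GradedRing.proj 𝒜 n a = 0 :=
  DirectSum.decompose_of_mem_ne _ ha h

lemma proj_zero_mul (a b : A) :
    GradedRing.proj 𝒜 0 (a * b) = GradedRing.proj 𝒜 0 a * GradedRing.proj 𝒜 0 b :=
  map_mul (GradedRing.projZeroRingHom 𝒜) a b

lemma proj_mul_of_right_mem {n : ℕ} (a : A) {b : A} (hb : b ∈ 𝒜 n) :
    GradedRing.proj 𝒜 n (a * b) = GradedRing.proj 𝒜 0 a * b := by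
  have h := DirectSum.coe_decompose_mul_add_of_right_mem 𝒜 (i := 0) (a := a) hb
  rwa [zero_add] at h

lemma proj_mul_of_right_mem_zero (n : ℕ) (a : A) {b : A} (hb : b ∈ 𝒜 0) :
    GradedRing.proj 𝒜 n (a * b) = GradedRing.proj 𝒜 n a * b :=
  DirectSum.coe_decompose_mul_of_right_mem_zero 𝒜 hb

variable {𝒜}

lemma mem_of_proj_eq_zero {n : ℕ} {a : A} (h : ∀ m, m ≠ n → GradedRing.proj 𝒜 m a = 0) :
    a ∈ 𝒜 n := by
  classical
  rw [← DirectSum.sum_support_decompose 𝒜 a]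
  refine sum_mem fun m _ ↦ ?_
  rcases eq_or_ne m n with rfl | hm
  · exact SetLike.coe_mem _
  · have h0 := h m hm
    rw [GradedRing.proj_apply] at h0
    rw [h0]
    exact zero_mem _

lemma eq_zero_of_proj_eq_zero {a : A} (h : ∀ n, GradedRing.proj 𝒜 n a = 0) : a = 0 := by
  classical
  rw [← DirectSum.sum_support_decompose 𝒜 a]
  exact Finset.sum_eq_zero fun n _ ↦ h n

lemma proj_zero_mul_derivation_eq {R : Type*} [CommRing R] [Algebra R A] {D : Derivation R A A}
    (hD : ∀ a ∈ 𝒜 0, D a = 0) {n : ℕ} {g δ t c : A} (hg : g ∈ 𝒜 n) (hδ : δ ∈ 𝒜 0)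
    (h : t * g = c * δ) : GradedRing.proj 𝒜 0 t * D g = D (GradedRing.proj 𝒜 n c) * δ := by
  have hn := congr_arg (GradedRing.proj 𝒜 n) h
  rw [proj_mul_of_right_mem 𝒜 t hg, proj_mul_of_right_mem_zero 𝒜 n c hδ] at hn
  have hDn := congr_arg D hn
  rw [Derivation.leibniz, Derivation.leibniz, hD _ (proj_mem 𝒜 0 t), hD δ hδ] at hDn
  simpa only [smul_eq_mul, mul_zero, add_zero, zero_add, mul_comm δ] using hDn

section AtPrime

variable [IsDomain A] {p : Ideal A} [p.IsPrime] {L : Type*} [CommRing L] [Algebra A L]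
  [IsLocalization.AtPrime L p]

lemma proj_zero_ne_zero_of_dvd (hp : ∀ a, GradedRing.proj 𝒜 0 a ∈ p ↔ a ∈ p) {f a : A}
    (ha : a ∈ 𝒜 0) (ha0 : a ≠ 0) (h : algebraMap A L f ∣ algebraMap A L a) :
    GradedRing.proj 𝒜 0 f ≠ 0 := by
  intro h0
  obtain ⟨s, hs, c, hc⟩ := (algebraMap_dvd_algebraMap_iff (p := p)).1 h
  have h1 := congr_arg (GradedRing.proj 𝒜 0) hc
  rw [proj_zero_mul, proj_zero_mul, h0, zero_mul, proj_of_mem 𝒜 ha, mul_eq_zero] at h1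
  exact hs ((hp s).1 (h1.resolve_right ha0 ▸ p.zero_mem))

lemma algebraMap_proj_zero_dvd (hp : ∀ a, GradedRing.proj 𝒜 0 a ∈ p ↔ a ∈ p) {f : A}
    (hf : GradedRing.proj 𝒜 0 f ≠ 0)
    (h : algebraMap A L f ∣ algebraMap A L (GradedRing.proj 𝒜 0 f)) :
    algebraMap A L (GradedRing.proj 𝒜 0 f) ∣ algebraMap A L f := by
  obtain ⟨s, hs, c, hc⟩ := (algebraMap_dvd_algebraMap_iff (p := p)).1 h
  have h1 := congr_arg (GradedRing.proj 𝒜 0) hc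
  rw [proj_zero_mul, proj_zero_mul, proj_of_mem 𝒜 (proj_mem 𝒜 0 f),
    mul_comm _ (GradedRing.proj 𝒜 0 c)] at h1
  refine (algebraMap_dvd_algebraMap_iff (p := p)).2 ⟨c, fun hcp ↦ hs ?_, s, ?_⟩
  · rw [← hp, mul_right_cancel₀ hf h1]
    exact (hp c).2 hcp
  · rw [mul_comm c, ← hc, mul_comm]

end AtPrime

end GradedRing

section Generator

variable {A B : Type*} [CommRing A] [CommRing B] [IsDomain B] {𝒜 : ℕ → AddSubgroup A}
  [GradedRing 𝒜] {ℬ : ℕ → AddSubgroup B} [GradedRing ℬ] {φ : A →+* B} {p : Ideal B} [p.IsPrime]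
  {L : Type*} [CommRing L] [Algebra B L] [IsLocalization.AtPrime L p]

lemma exists_proj_zero_dvd_of_map_eq_span_singleton
    (hφ : ∀ a, GradedRing.proj ℬ 0 (φ a) = φ (GradedRing.proj 𝒜 0 a))
    (hp : ∀ b, GradedRing.proj ℬ 0 b ∈ p ↔ b ∈ p) {J : Ideal A}
    (hJ : ∀ a ∈ J, GradedRing.proj 𝒜 0 a ∈ J) {a₀ : A} (ha₀ : a₀ ∈ J) (ha₀gr : a₀ ∈ 𝒜 0)
    (hφa₀ : φ a₀ ≠ 0) {g : L} (hg : J.map ((algebraMap B L).comp φ) = Ideal.span {g}) :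
    ∃ f ∈ J, φ (GradedRing.proj 𝒜 0 f) ≠ 0 ∧
      ∀ a ∈ J, algebraMap B L (φ (GradedRing.proj 𝒜 0 f)) ∣ algebraMap B L (φ a) := by
  have := IsLocalization.AtPrime.isLocalRing L p
  have := IsLocalization.isDomain_of_le_nonZeroDivisors (S := L) p.primeCompl_le_nonZeroDivisors
  have hinj := IsLocalization.injective L p.primeCompl_le_nonZeroDivisors
  have hg0 : g ≠ 0 := by
    rintro rfl
    have h := hg ▸ Ideal.mem_map_of_mem ((algebraMap B L).comp φ) ha₀
    rw [Ideal.span_singleton_zero, Ideal.mem_bot] at h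
    exact hφa₀ (hinj (h.trans (map_zero _).symm))
  obtain ⟨_, ⟨f, hf, rfl⟩, -, hfdvd⟩ := exists_dvd_of_span_eq_span_singleton hg0 hg
  have hdvd (a : A) (ha : a ∈ J) : algebraMap B L (φ f) ∣ algebraMap B L (φ a) :=
    hfdvd _ ⟨a, ha, rfl⟩
  have ha₀ℬ : φ a₀ ∈ ℬ 0 := by
    rw [← proj_of_mem 𝒜 ha₀gr, ← hφ]
    exact proj_mem ℬ 0 _
  have hf₀ := proj_zero_ne_zero_of_dvd hp ha₀ℬ hφa₀ (hdvd a₀ ha₀)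
  have hf₀dvd := algebraMap_proj_zero_dvd hp (L := L) hf₀
  rw [hφ] at hf₀ hf₀dvd
  exact ⟨f, hf, hf₀, fun a ha ↦ (hf₀dvd (hdvd _ (hJ f hf))).trans (hdvd a ha)⟩

lemma exists_dvd_of_map_eq_span_singleton
    (hφ : ∀ a, GradedRing.proj ℬ 0 (φ a) = φ (GradedRing.proj 𝒜 0 a))
    (hp : ∀ b, GradedRing.proj ℬ 0 b ∈ p ↔ b ∈ p) {J : Ideal A} {s : Set A} (hsJ : s ⊆ J)
    (hJs : ∀ a ∈ J, GradedRing.proj 𝒜 0 a ∈ Ideal.span s) {a₀ : A} (ha₀ : a₀ ∈ J)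
    (ha₀gr : a₀ ∈ 𝒜 0) (hφa₀ : φ a₀ ≠ 0) {g : L}
    (hg : J.map ((algebraMap B L).comp φ) = Ideal.span {g}) :
    ∃ δ ∈ s, φ δ ≠ 0 ∧ ∀ a ∈ J, algebraMap B L (φ δ) ∣ algebraMap B L (φ a) := by
  have := IsLocalization.AtPrime.isLocalRing L p
  have := IsLocalization.isDomain_of_le_nonZeroDivisors (S := L) p.primeCompl_le_nonZeroDivisors
  obtain ⟨f, hf, hf₀, hdvd⟩ := exists_proj_zero_dvd_of_map_eq_span_singleton hφ hp
    (fun a ha ↦ Ideal.span_le.2 hsJ (hJs a ha)) ha₀ ha₀gr hφa₀ hg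
  let ψ : A →+* L := (algebraMap B L).comp φ
  have hψf₀ : ψ (GradedRing.proj 𝒜 0 f) ≠ 0 := fun h ↦
    hf₀ (IsLocalization.injective L p.primeCompl_le_nonZeroDivisors (h.trans (map_zero _).symm))
  have hspan : Ideal.span (ψ '' s) = Ideal.span {ψ (GradedRing.proj 𝒜 0 f)} := by
    apply le_antisymm
    · rw [Ideal.span_le]
      rintro _ ⟨a, ha, rfl⟩
      exact Ideal.mem_span_singleton.2 (hdvd a (hsJ ha))
    · rw [Ideal.span_singleton_le_iff_mem, ← Ideal.map_span]
      exact Ideal.mem_map_of_mem ψ (hJs f hf)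
  obtain ⟨_, ⟨δ, hδ, rfl⟩, hδne, hδdvd⟩ := exists_dvd_of_span_eq_span_singleton hψf₀ hspan
  have hle : Ideal.span (ψ '' s) ≤ Ideal.span {ψ δ} :=
    Ideal.span_le.2 fun a ha ↦ Ideal.mem_span_singleton.2 (hδdvd a ha)
  have hδf₀ : ψ δ ∣ ψ (GradedRing.proj 𝒜 0 f) :=
    Ideal.mem_span_singleton.1 (hle (hspan ▸ Ideal.mem_span_singleton_self _))
  exact ⟨δ, hδ, fun h ↦ hδne (by simp only [ψ, RingHom.comp_apply, h, map_zero]),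
    fun a ha ↦ hδf₀.trans (hdvd a ha)⟩

end Generator

/-! ### Laurent polynomials -/

section Laurent

open LaurentPolynomial

lemma coeff_mul_T {R : Type*} [CommRing R] (p : R[T;T⁻¹]) (m n : ℤ) :
    (p * T m).coeff (n + m) = p.coeff n := by
  simpa using AddMonoidAlgebra.coeff_mul_single_add p 1 m n

lemma coeff_C_mul_T {R : Type*} [CommRing R] (a : R) (m n : ℤ) :
    (C a * T m).coeff n = if m = n then a else 0 := by
  rw [← single_eq_C_mul_T, AddMonoidAlgebra.coeff_single, Finsupp.single_apply]

variable {A : Type*} [CommRing A] (𝒜 : ℕ → AddSubgroup A) [GradedRing 𝒜]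

/-- The co-action `∑ aₙ ↦ ∑ aₙ tⁿ` of `𝔾ₘ` on a graded ring. -/
def laurentMap : A →+* A[T;T⁻¹] :=
  (DirectSum.toSemiring
    (fun n : ℕ ↦
      ((AddMonoidHom.mulRight (T (n : ℤ))).comp C.toAddMonoidHom).comp (𝒜 n).subtype)
    (by change C (1 : A) * T ((0 : ℕ) : ℤ) = 1; simp)
    (fun {m n} a b ↦ by
      change C (a * b : A) * T ((m + n : ℕ) : ℤ) = C (a : A) * T (m : ℤ) * (C (b : A) * T (n : ℤ))
      rw [Nat.cast_add, T_add, map_mul, mul_mul_mul_comm])).comp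
    (DirectSum.decomposeRingEquiv 𝒜).toRingHom

variable {𝒜}

lemma laurentMap_of_mem {n : ℕ} {a : A} (ha : a ∈ 𝒜 n) : laurentMap 𝒜 a = C a * T (n : ℤ) := by
  lift a to 𝒜 n using ha
  simp [laurentMap, DirectSum.decomposeRingEquiv]

lemma coeff_laurentMap (a : A) (n : ℕ) :
    (laurentMap 𝒜 a).coeff (n : ℤ) = GradedRing.proj 𝒜 n a := by
  induction a using DirectSum.Decomposition.inductionOn 𝒜 with
  | zero => simp
  | add a b ha hb => simp [ha, hb]
  | @homogeneous m a =>
    rw [laurentMap_of_mem a.2, coeff_C_mul_T]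
    split_ifs with h
    · rw [← Int.natCast_inj.1 h, proj_of_mem 𝒜 a.2]
    · rw [proj_of_mem_of_ne 𝒜 a.2 (mod_cast h)]

lemma eval₂_comp_C {R S : Type*} [CommRing R] [CommRing S] (φ : R[T;T⁻¹] →+* S) {t : Sˣ}
    (ht : (t : S) = φ (T 1)) (p : R[T;T⁻¹]) : eval₂ (φ.comp C) t p = φ p := by
  refine p.reduce_to_polynomial_of_mul_T (Q := fun p ↦ eval₂ (φ.comp C) t p = φ p)
    (fun q ↦ ?_) fun q hq ↦ ?_
  · rw [eval₂_toLaurent, ht]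
    induction q using Polynomial.induction_on' with
    | add p q hp hq => simp only [Polynomial.eval₂_add, hp, hq, map_add]
    | monomial n a =>
      rw [Polynomial.eval₂_monomial, Polynomial.toLaurent_C_mul_T, map_mul, ← map_pow, T_pow,
        mul_one, RingHom.comp_apply]
  · rw [map_mul, map_mul, eval₂_T, zpow_one, ← ht] at hq
    exact t.mul_left_inj.1 hq

lemma coeff_eval₂_C_mul_X {σ R L : Type*} [CommRing R] [CommRing L] (θ : R →+* L) (τ : L)
    (p : MvPolynomial σ R) (α : σ →₀ ℕ) :
    (p.eval₂ (MvPolynomial.C.comp θ) fun i ↦ MvPolynomial.C τ * MvPolynomial.X i).coeff α =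
      θ (p.coeff α) * τ ^ α.degree := by
  classical
  induction p using MvPolynomial.induction_on' with
  | monomial β a =>
    have h : (β.prod fun i n ↦ (MvPolynomial.C τ * MvPolynomial.X i) ^ n) =
        MvPolynomial.monomial β (τ ^ β.degree) := by
      simp only [mul_pow, Finsupp.prod_mul, MvPolynomial.monomial_eq, ← map_pow]
      congr 1
      rw [Finsupp.prod, ← map_prod, Finset.prod_pow_eq_pow_sum]
      rfl
    rw [MvPolynomial.eval₂_monomial, h, RingHom.comp_apply, MvPolynomial.C_mul_monomial,
      MvPolynomial.coeff_monomial, MvPolynomial.coeff_monomial]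
    split_ifs with hβ
    · rw [hβ]
    · rw [map_zero, zero_mul]
  | add p q hp hq => simp only [MvPolynomial.eval₂_add, MvPolynomial.coeff_add, hp, hq, map_add,
      add_mul]

end Laurent

/-! ### Morphisms into affine open subschemes -/

lemma toSpecΓ_specMap_appLE_fromSpec {T Y : Scheme.{u}} (x : T ⟶ Y) {U : Y.Opens}
    (hU : IsAffineOpen U) (h : ⊤ ≤ x ⁻¹ᵁ U) :
    T.toSpecΓ ≫ Spec.map (x.appLE U ⊤ h) ≫ hU.fromSpec = x := by
  have h1 := congr($(Scheme.Opens.toSpecΓ_SpecMap_appLE x U ⊤ h) ≫ hU.fromSpec)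
  rw [Scheme.Opens.toSpecΓ_top, Category.assoc, Category.assoc, Category.assoc,
    hU.toSpecΓ_fromSpec, Scheme.Hom.resLE_comp_ι, ← Scheme.topIso_hom] at h1
  exact (cancel_epi _).1 h1

lemma hom_ext_of_appLE {T Y : Scheme.{u}} {x y : T ⟶ Y} {U : Y.Opens}
    (hU : IsAffineOpen U) (hx : ⊤ ≤ x ⁻¹ᵁ U) (hy : ⊤ ≤ y ⁻¹ᵁ U)
    (h : ∀ f, (x.appLE U ⊤ hx).hom f = (y.appLE U ⊤ hy).hom f) : x = y := by
  rw [← toSpecΓ_specMap_appLE_fromSpec x hU hx, ← toSpecΓ_specMap_appLE_fromSpec y hU hy]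
  congr 3
  ext f
  exact h f

lemma fromSpec_appLE_self {Y : Scheme.{u}} {U : Y.Opens} (hU : IsAffineOpen U) (h) :
    hU.fromSpec.appLE U ⊤ h = (Scheme.ΓSpecIso _).inv := by
  rw [Scheme.Hom.appLE, hU.fromSpec_app_self, Category.assoc, ← Functor.map_comp]
  exact (congr_arg _ (CategoryTheory.Functor.map_id _ _)).trans (Category.comp_id _)

lemma top_le_specMap_fromSpec {Y : Scheme.{u}} {U : Y.Opens} (hU : IsAffineOpen U)
    {P : CommRingCat.{u}} (ψ : Γ(Y, U) ⟶ P) : ⊤ ≤ (Spec.map ψ ≫ hU.fromSpec) ⁻¹ᵁ U := by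
  intro p _
  simp

lemma specMap_fromSpec_appLE {Y : Scheme.{u}} {U : Y.Opens} (hU : IsAffineOpen U)
    {P : CommRingCat.{u}} (ψ : Γ(Y, U) ⟶ P) (h) :
    (Spec.map ψ ≫ hU.fromSpec).appLE U ⊤ h = ψ ≫ (Scheme.ΓSpecIso P).inv := by
  rw [← Scheme.Hom.appLE_comp_appLE _ _ U ⊤ ⊤ hU.fromSpec_preimage_self.ge le_rfl,
    fromSpec_appLE_self, Scheme.ΓSpecIso_inv_naturality]
  exact congr_arg _ (Scheme.Hom.app_eq_appLE _).symm

lemma appLE_top {T Y : Scheme.{u}} (x : T ⟶ Y) (h : ⊤ ≤ x ⁻¹ᵁ ⊤) :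
    x.appLE ⊤ ⊤ h = x.appTop :=
  (Scheme.Hom.app_eq_appLE _).symm

lemma appLE_comp_apply {T Y Z : Scheme.{u}} (x : T ⟶ Y) (p : Y ⟶ Z) {V : Y.Opens} {U : Z.Opens}
    (hx : ⊤ ≤ x ⁻¹ᵁ V) (hp : V ≤ p ⁻¹ᵁ U) (h : ⊤ ≤ (x ≫ p) ⁻¹ᵁ U) (f : Γ(Z, U)) :
    ((x ≫ p).appLE U ⊤ h).hom f = (x.appLE V ⊤ hx).hom ((p.appLE U V hp).hom f) := by
  rw [← Scheme.Hom.appLE_comp_appLE x p U V ⊤ hp hx]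
  rfl

lemma appLE_congr_hom {T Y : Scheme.{u}} {x y : T ⟶ Y} (e : x = y) {U : Y.Opens}
    (hx : ⊤ ≤ x ⁻¹ᵁ U) (hy : ⊤ ≤ y ⁻¹ᵁ U) (f : Γ(Y, U)) :
    (x.appLE U ⊤ hx).hom f = (y.appLE U ⊤ hy).hom f := by
  subst e
  rfl

lemma specFun_injective (P : CommRingCat.{u}) : Function.Injective (specFun (R := P)) :=
  (Scheme.ΓSpecIso P).symm.commRingCatIsoToRingEquiv.injective

namespace Cone

variable {k : Type u} [Field k] {r w : ℕ} (X : Cone k r w) {U : X.S.left.affineOpens}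

/-! ### The actions in terms of the co-actions -/

section Actions

variable {T : SchOver k} {x : T ⟶ X.C} (h : ⊤ ≤ x.left ⁻¹ᵁ (X.π.left ⁻¹ᵁ U))

include h

lemma top_le_ga (u : Fin r → Γ(T.left, ⊤)) :
    ⊤ ≤ (X.ga.act u x).left ⁻¹ᵁ (X.π.left ⁻¹ᵁ U) := by
  have := congr($(X.ga_invariant u x).left)
  rw [Over.comp_left, Over.comp_left] at this
  rwa [← Scheme.Hom.comp_preimage, this, Scheme.Hom.comp_preimage]

lemma top_le_gm (t : (Γ(T.left, ⊤))ˣ) : ⊤ ≤ (X.gm.act t x).left ⁻¹ᵁ (X.π.left ⁻¹ᵁ U) := by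
  have := congr($(X.gm_invariant t x).left)
  rw [Over.comp_left, Over.comp_left] at this
  rwa [← Scheme.Hom.comp_preimage, this, Scheme.Hom.comp_preimage]

lemma ga_appLE (u : Fin r → Γ(T.left, ⊤)) (f : X.alg U) :
    ((X.ga.act u x).left.appLE _ ⊤ (X.top_le_ga h u)).hom f =
      (X.coaction U f).eval₂ (x.left.appLE _ ⊤ h).hom u := by
  let e : MvPolynomial (Fin r) (X.alg U) →+* Γ(T.left, ⊤) :=
    MvPolynomial.eval₂Hom (x.left.appLE _ ⊤ h).hom u
  let s : T.left ⟶ Spec (.of (MvPolynomial (Fin r) (X.alg U))) :=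
    T.left.toSpecΓ ≫ Spec.map (CommRingCat.ofHom e)
  have hs : s ≫ X.proj U = x.left := by
    rw [proj, Category.assoc, ← Spec.map_comp_assoc, ← CommRingCat.ofHom_comp,
      show e.comp MvPolynomial.C = (x.left.appLE _ ⊤ h).hom from RingHom.ext fun a ↦ by simp [e]]
    exact toSpecΓ_specMap_appLE_fromSpec x.left (X.isAffineOpen_preimage U) h
  let s' : T ⟶ X.prodOver U := Over.homMk s (by
    change s ≫ X.proj U ≫ X.C.hom = T.hom
    rw [← Category.assoc, hs, Over.w])
  have hs' : s' ≫ X.projOver U = x := by ext1; exact hs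
  have hsapp : s.appTop = (Scheme.ΓSpecIso _).hom ≫ CommRingCat.ofHom e := by
    rw [Scheme.Hom.comp_appTop, Scheme.toSpecΓ_appTop]
    exact Scheme.ΓSpecIso_naturality (CommRingCat.ofHom e)
  have hact : X.ga.act u x = s' ≫ X.action U := by
    rw [action, X.ga.naturality, hs']
    congr 1
    funext i
    change _ = s.appTop.hom _
    rw [hsapp]
    simp [e]
  have hle : ⊤ ≤ (s' ≫ X.action U).left ⁻¹ᵁ (X.π.left ⁻¹ᵁ U) := hact ▸ X.top_le_ga h u
  refine (appLE_congr_hom congr($(hact).left) _ hle f).trans ?_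
  refine (appLE_comp_apply s (X.action U).left (V := ⊤) le_rfl (X.top_le_action U) hle f).trans ?_
  exact congr($((appLE_top s le_rfl).trans hsapp).hom _)

end Actions

/-! ### The grading -/

/-- The grading of `𝒜(U)` by the weights of `𝔾ₘ`. -/
abbrev gr (U : X.S.left.affineOpens) : ℕ → AddSubgroup (X.alg U) :=
  X.gm.weight (X.π.left ⁻¹ᵁ U)

instance gradedMonoid (U : X.S.left.affineOpens) : SetLike.GradedMonoid (X.gr U) where
  one_mem := by
    intro T t x h h'
    simp
  mul_mem := by
    intro m n f g hf hg T t x h h'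
    rw [map_mul, map_mul, hf T t x h h', hg T t x h h']
    ring

instance gradedRing (U : X.S.left.affineOpens) : GradedRing (X.gr U) :=
  { X.gradedMonoid U, (X.isInternal U).chooseDecomposition with }

lemma mem_gr_zero {f : X.alg U} : f ∈ X.gr U 0 ↔ ∃ a, (X.π.left.app U).hom a = f := by
  rw [gr, X.weight_zero U]
  rfl

lemma mem_posIdeal {n : ℕ} (hn : 0 < n) {f : X.alg U} (hf : f ∈ X.gr U n) : f ∈ X.posIdeal U :=
  Ideal.subset_span ⟨n, hn, hf⟩

lemma mem_posIdeal_iff {f : X.alg U} : f ∈ X.posIdeal U ↔ GradedRing.proj (X.gr U) 0 f = 0 := by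
  constructor
  · intro hf
    have h : X.posIdeal U ≤ RingHom.ker (GradedRing.projZeroRingHom (X.gr U)) := by
      rw [posIdeal, Ideal.span_le]
      rintro f ⟨n, hn, hf⟩
      exact proj_of_mem_of_ne _ hf hn.ne'
    exact h hf
  · intro hf
    classical
    rw [← DirectSum.sum_support_decompose (X.gr U) f]
    refine sum_mem fun n _ ↦ ?_
    rcases n.eq_zero_or_pos with rfl | hn
    · rw [GradedRing.proj_apply] at hf
      rw [hf]
      exact zero_mem _
    · exact X.mem_posIdeal hn (SetLike.coe_mem _)

lemma sub_proj_zero_mem_posIdeal (f : X.alg U) :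
    f - GradedRing.proj (X.gr U) 0 f ∈ X.posIdeal U := by
  rw [mem_posIdeal_iff, map_sub, proj_of_mem _ (proj_mem _ 0 f), sub_self]

section Actions

variable {T : SchOver k} {x : T ⟶ X.C} (h : ⊤ ≤ x.left ⁻¹ᵁ (X.π.left ⁻¹ᵁ U))

lemma gm_appLE_of_mem (t : (Γ(T.left, ⊤))ˣ) {n : ℕ} {f : X.alg U} (hf : f ∈ X.gr U n) :
    ((X.gm.act t x).left.appLE _ ⊤ (X.top_le_gm h t)).hom f =
      (t : Γ(T.left, ⊤)) ^ n * (x.left.appLE _ ⊤ h).hom f :=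
  hf T t x h (X.top_le_gm h t)

lemma gm_appLE (t : (Γ(T.left, ⊤))ˣ) (f : X.alg U) :
    ((X.gm.act t x).left.appLE _ ⊤ (X.top_le_gm h t)).hom f =
      (laurentMap (X.gr U) f).eval₂ (x.left.appLE _ ⊤ h).hom t := by
  induction f using DirectSum.Decomposition.inductionOn (X.gr U) with
  | zero => simp
  | add a b ha hb => simp only [map_add, ha, hb]
  | homogeneous a =>
    rw [X.gm_appLE_of_mem h t a.2, laurentMap_of_mem a.2, LaurentPolynomial.eval₂_C_mul_T_n,
      mul_comm]

lemma eval₂_gm_coaction (t : (Γ(T.left, ⊤))ˣ) (u : Fin r → Γ(T.left, ⊤)) {n : ℕ} {f : X.alg U}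
    (hf : f ∈ X.gr U n) :
    (X.coaction U f).eval₂ ((X.gm.act t x).left.appLE _ ⊤ (X.top_le_gm h t)).hom
        (fun i ↦ (t : Γ(T.left, ⊤)) ^ w * u i) =
      (t : Γ(T.left, ⊤)) ^ n * (X.coaction U f).eval₂ (x.left.appLE _ ⊤ h).hom u := by
  rw [← X.ga_appLE h u, ← X.gm_appLE_of_mem (X.top_le_ga h u) t hf, ← X.ga_appLE]
  exact appLE_congr_hom congr($(X.semidirect t u x).left).symm _ _ f

end Actions

/-! ### The degree of the co-action -/

/-- The `k`-scheme `Spec P` over `π⁻¹ U`. -/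
abbrev affOver (U : X.S.left.affineOpens) {P : Type u} [CommRing P] (ψ : X.alg U →+* P) :
    SchOver k :=
  Over.mk (Spec.map (CommRingCat.ofHom ψ) ≫ (X.isAffineOpen_preimage U).fromSpec ≫ X.C.hom)

/-- The point of `C` with values in `P` given by a homomorphism `𝒜(U) → P`. -/
abbrev affPoint (U : X.S.left.affineOpens) {P : Type u} [CommRing P] (ψ : X.alg U →+* P) :
    X.affOver U ψ ⟶ X.C :=
  Over.homMk (Spec.map (CommRingCat.ofHom ψ) ≫ (X.isAffineOpen_preimage U).fromSpec)
    (Category.assoc _ _ _)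

lemma top_le_affPoint {P : Type u} [CommRing P] (ψ : X.alg U →+* P) :
    ⊤ ≤ (X.affPoint U ψ).left ⁻¹ᵁ (X.π.left ⁻¹ᵁ U) :=
  top_le_specMap_fromSpec _ _

lemma affPoint_appLE {P : Type u} [CommRing P] (ψ : X.alg U →+* P) :
    ((X.affPoint U ψ).left.appLE (X.π.left ⁻¹ᵁ U) ⊤ (X.top_le_affPoint ψ)).hom =
      (specFun (R := .of P)).comp ψ :=
  congr($(specMap_fromSpec_appLE (X.isAffineOpen_preimage U) (CommRingCat.ofHom ψ)
    (X.top_le_affPoint ψ)).hom)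

open LaurentPolynomial in
-- Compares the coefficients of `u ^ α` in `f((t ^ w u).(t.x)) = f(t.(u.x))` for universal `x`, `t`
-- and `u`.
lemma laurentMap_coeff_coaction {n : ℕ} {f : X.alg U} (hf : f ∈ X.gr U n) (α : Fin r →₀ ℕ) :
    laurentMap (X.gr U) ((X.coaction U f).coeff α) * T ((w * α.degree : ℕ) : ℤ) =
      LaurentPolynomial.C ((X.coaction U f).coeff α) * T (n : ℤ) := by
  let P := MvPolynomial (Fin r) (X.alg U)[T;T⁻¹]
  let ψ : X.alg U →+* P := MvPolynomial.C.comp LaurentPolynomial.C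
  let σ : P →+* Γ((X.affOver U ψ).left, ⊤) := specFun (R := .of P)
  let t : (Γ((X.affOver U ψ).left, ⊤))ˣ :=
    Units.map (σ.comp MvPolynomial.C).toMonoidHom (isUnit_T 1).unit
  let v (c : (X.alg U)[T;T⁻¹]) : Fin r → P := fun i ↦ MvPolynomial.C c * MvPolynomial.X i
  have hx := X.top_le_affPoint ψ
  have ht (m : ℕ) : (t : Γ((X.affOver U ψ).left, ⊤)) ^ m = σ (MvPolynomial.C (T (m : ℤ))) := by
    rw [← mul_one (m : ℤ), ← T_pow, map_pow, map_pow]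
    rfl
  have hv : (fun i ↦ (t : Γ((X.affOver U ψ).left, ⊤)) ^ w * σ (v 1 i)) =
      σ ∘ v (T (w : ℤ)) := by
    funext i
    simp only [ht, v, Function.comp_apply, map_mul, map_one, one_mul]
  have hψ : ((X.affPoint U ψ).left.appLE _ ⊤ hx).hom = σ.comp ψ := X.affPoint_appLE ψ
  have hgm : ((X.gm.act t (X.affPoint U ψ)).left.appLE _ ⊤ (X.top_le_gm hx t)).hom =
      σ.comp (MvPolynomial.C.comp (laurentMap (X.gr U))) := by
    ext a
    rw [X.gm_appLE hx, hψ]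
    exact eval₂_comp_C (σ.comp MvPolynomial.C) rfl _
  have h := X.eval₂_gm_coaction hx t (σ ∘ v 1) hf
  simp only [Function.comp_apply] at h
  rw [hgm, hψ, hv, ht, ← MvPolynomial.eval₂_comp_left, ← MvPolynomial.eval₂_comp_left,
    ← map_mul] at h
  have hα := congr_arg (MvPolynomial.coeff α) (specFun_injective (.of P) h)
  rw [MvPolynomial.coeff_C_mul, coeff_eval₂_C_mul_X, coeff_eval₂_C_mul_X, T_pow, one_pow,
    mul_one, mul_comm (T _)] at hα
  rwa [Nat.cast_mul, mul_comm (w : ℤ)]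

lemma proj_coeff_coaction {n : ℕ} {f : X.alg U} (hf : f ∈ X.gr U n) (α : Fin r →₀ ℕ) {m : ℕ}
    (hm : m + w * α.degree ≠ n) :
    GradedRing.proj (X.gr U) m ((X.coaction U f).coeff α) = 0 := by
  have h := congr(($(X.laurentMap_coeff_coaction hf α)).coeff ((m : ℤ) + (w * α.degree : ℕ)))
  rwa [coeff_mul_T, coeff_laurentMap, coeff_C_mul_T, if_neg (by exact_mod_cast hm.symm)] at h

lemma coeff_coaction_eq_zero {n : ℕ} {f : X.alg U} (hf : f ∈ X.gr U n) (α : Fin r →₀ ℕ)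
    (hn : n < w * α.degree) : (X.coaction U f).coeff α = 0 :=
  eq_zero_of_proj_eq_zero fun _ ↦ X.proj_coeff_coaction hf α (by lia)

lemma coeff_coaction_mem {n m : ℕ} {f : X.alg U} (hf : f ∈ X.gr U n) (α : Fin r →₀ ℕ)
    (hn : m + w * α.degree = n) : (X.coaction U f).coeff α ∈ X.gr U m :=
  mem_of_proj_eq_zero fun _ hm ↦ X.proj_coeff_coaction hf α (by lia)

end Cone

/-! ### First order terms of polynomials -/

lemma constantCoeff_pderiv {σ R : Type*} [CommRing R] (i : σ) (p : MvPolynomial σ R) :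
    MvPolynomial.constantCoeff (MvPolynomial.pderiv i p) = p.coeff (Finsupp.single i 1) := by
  rw [MvPolynomial.constantCoeff_eq, MvPolynomial.coeff_pderiv]
  simp

lemma exists_eq_single_of_degree_eq_one {σ : Type*} {α : σ →₀ ℕ} (h : α.degree = 1) :
    ∃ i, α = Finsupp.single i 1 := by
  obtain ⟨i, hi⟩ : ∃ i, α i ≠ 0 := by
    refine Finsupp.ne_iff.1 (?_ : α ≠ 0)
    rintro rfl
    simp at h
  have hle : Finsupp.single i 1 ≤ α := Finsupp.single_le_iff.2 (Nat.one_le_iff_ne_zero.2 hi)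
  have h1 := congr_arg Finsupp.degree (add_tsub_cancel_of_le hle)
  rw [map_add, Finsupp.degree_single, h, add_eq_left, Finsupp.degree_eq_zero_iff] at h1
  exact ⟨i, by rw [← add_tsub_cancel_of_le hle, h1, add_zero]⟩

lemma eval₂_inr {σ R k : Type*} [Fintype σ] [CommRing R] [CommRing k] (φ : R →+* k) (ξ : σ → k)
    (p : MvPolynomial σ R) :
    p.eval₂ ((algebraMap k (DualNumber k)).comp φ) (fun i ↦ TrivSqZeroExt.inr (ξ i)) =
      TrivSqZeroExt.inl (φ (p.coeff 0)) +
        TrivSqZeroExt.inr (∑ i, ξ i * φ (p.coeff (Finsupp.single i 1))) := by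
  classical
  induction p using MvPolynomial.induction_on with
  | C a =>
    have (i : σ) : (0 : σ →₀ ℕ) ≠ Finsupp.single i 1 := by simp [eq_comm]
    simp [MvPolynomial.coeff_C, this, TrivSqZeroExt.algebraMap_eq_inl]
  | add p q hp hq =>
    simp only [MvPolynomial.eval₂_add, hp, hq, MvPolynomial.coeff_add, map_add, mul_add,
      Finset.sum_add_distrib, TrivSqZeroExt.inl_add, TrivSqZeroExt.inr_add]
    abel
  | mul_X p j hp =>
    have h0 : (p * MvPolynomial.X j).coeff 0 = 0 := by
      rw [MvPolynomial.coeff_mul_X']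
      simp
    have h1 (i : σ) : (p * MvPolynomial.X j).coeff (Finsupp.single i 1) =
        if i = j then p.coeff 0 else 0 := by
      rw [MvPolynomial.coeff_mul_X']
      by_cases hij : i = j
      · simp [hij]
      · simp [hij, Ne.symm hij]
    rw [MvPolynomial.eval₂_mul, hp, MvPolynomial.eval₂_X]
    simp only [h0, h1]
    ext <;> simp [apply_ite φ, mul_comm]

namespace Cone

variable {k : Type u} [Field k] {r w : ℕ} (X : Cone k r w) {U : X.S.left.affineOpens}

/-! ### The vector fields -/

lemma vectorField_apply (i : Fin r) (f : X.alg U) :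
    X.vectorField U i f = (X.coaction U f).coeff (Finsupp.single i 1) :=
  constantCoeff_pderiv i _

lemma vectorField_of_mem_zero (i : Fin r) {f : X.alg U} (hf : f ∈ X.gr U 0) :
    X.vectorField U i f = 0 := by
  obtain ⟨a, rfl⟩ := X.mem_gr_zero.1 hf
  exact (X.vectorField U i).map_algebraMap a

lemma vectorField_mem (i : Fin r) {n : ℕ} {f : X.alg U} (hf : f ∈ X.gr U (n + w)) :
    X.vectorField U i f ∈ X.gr U n := by
  rw [vectorField_apply]
  exact X.coeff_coaction_mem hf _ (by simp)

lemma proj_zero_vectorField (i : Fin r) (f : X.alg U) :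
    GradedRing.proj (X.gr U) 0 (X.vectorField U i f) =
      X.vectorField U i (GradedRing.proj (X.gr U) w f) := by
  induction f using DirectSum.Decomposition.inductionOn (X.gr U) with
  | zero => simp
  | add a b ha hb => simp only [map_add, ha, hb]
  | @homogeneous n a =>
    by_cases h : n = w
    · subst h
      rw [proj_of_mem _ a.2, proj_of_mem]
      exact X.vectorField_mem i (by simp)
    · rw [proj_of_mem_of_ne _ a.2 h, map_zero, vectorField_apply]
      exact X.proj_coeff_coaction a.2 _ (by simpa using Ne.symm h)

lemma conormalMap_D (f : X.alg U) :
    X.conormalMap U (KaehlerDifferential.D _ _ f) = fun i ↦ X.vectorField U i f := by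
  funext i
  simp [conormalMap]

lemma exists_vectorField_eq_proj_zero (ω : Ω[X.alg U⁄Γ(X.S.left, U)]) :
    ∃ h ∈ X.gr U w, ∀ i,
      GradedRing.proj (X.gr U) 0 (X.conormalMap U ω i) = X.vectorField U i h := by
  have hω : ω ∈ Submodule.span (X.alg U)
      (Set.range (KaehlerDifferential.D Γ(X.S.left, U) (X.alg U))) := by
    rw [KaehlerDifferential.span_range_derivation]
    trivial
  induction hω using Submodule.span_induction with
  | mem _ h =>
    obtain ⟨f, rfl⟩ := h
    refine ⟨GradedRing.proj (X.gr U) w f, proj_mem _ _ _, fun i ↦ ?_⟩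
    rw [conormalMap_D, proj_zero_vectorField]
  | zero => exact ⟨0, zero_mem _, fun i ↦ by simp⟩
  | add ω ω' _ _ h h' =>
    obtain ⟨h, hh, e⟩ := h
    obtain ⟨h', hh', e'⟩ := h'
    refine ⟨h + h', add_mem hh hh', fun i ↦ ?_⟩
    rw [map_add, Pi.add_apply, map_add, e, e', map_add]
  | smul a ω _ h =>
    obtain ⟨h, hh, e⟩ := h
    refine ⟨GradedRing.proj (X.gr U) 0 a * h, ?_, fun i ↦ ?_⟩
    · simpa using SetLike.GradedMul.mul_mem (proj_mem (X.gr U) 0 a) hh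
    · rw [map_smul, Pi.smul_apply, smul_eq_mul, proj_zero_mul, e, Derivation.leibniz,
        X.vectorField_of_mem_zero i (proj_mem (X.gr U) 0 a), smul_zero, add_zero, smul_eq_mul]

/-! ### The ideal of the centre -/

/-- The matrix `(ξ_{s j}.hᵢ)` of derivatives of the functions `h` along the basis vectors of `𝔲`
selected by `s`. -/
abbrev jacobian {n : ℕ} (h : Fin n → X.alg U) (s : Fin n → Fin r) :
    Matrix (Fin n) (Fin n) (X.alg U) :=
  .of fun i j ↦ X.vectorField U (s j) (h i)

/-- The minors of size `n` of the matrices of derivatives of functions of weight `w`: the degree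
zero part of the `n`-minors of the relations of `𝒬(π)`. -/
def minors (U : X.S.left.affineOpens) (n : ℕ) : Set (X.alg U) :=
  {δ | ∃ (h : Fin n → X.alg U) (s : Fin n → Fin r),
    (∀ i, h i ∈ X.gr U w) ∧ δ = (X.jacobian h s).det}

lemma jacobian_mem {n : ℕ} {h : Fin n → X.alg U} (hh : ∀ i, h i ∈ X.gr U w) (s : Fin n → Fin r)
    (i j : Fin n) : X.jacobian h s i j ∈ X.gr U 0 :=
  X.vectorField_mem (s j) (by simpa using hh i)

lemma minors_subset_gr_zero (n : ℕ) : X.minors U n ⊆ X.gr U 0 := by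
  rintro _ ⟨h, s, hh, rfl⟩
  exact det_mem_subring (S := SetLike.GradeZero.subring (X.gr U)) (X.jacobian_mem hh s)

lemma minors_subset_fit (d : ℕ) : X.minors U (r - d) ⊆ X.fit U d := by
  rintro _ ⟨h, s, -, rfl⟩
  refine Ideal.subset_span ⟨fun i ↦ ⟨X.conormalMap U (KaehlerDifferential.D _ _ (h i)), ?_⟩, s, ?_⟩
  · simp
  · simp [conormalMap_D]

lemma posIdeal_le_singIdeal (U : X.S.left.affineOpens) : X.posIdeal U ≤ X.singIdeal U :=
  le_sup_right

lemma mem_centreIdeal {f : X.alg U} :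
    f ∈ X.centreIdeal U ↔ ∀ α, (X.coaction U f).coeff α ∈ X.singIdeal U := by
  rw [centreIdeal, RingHom.mem_ker, RingHom.comp_apply, MvPolynomial.ext_iff]
  simp only [MvPolynomial.coeff_map, MvPolynomial.coeff_zero, Ideal.Quotient.eq_zero_iff_mem]

lemma centreIdeal_le_singIdeal (U : X.S.left.affineOpens) : X.centreIdeal U ≤ X.singIdeal U := by
  intro f hf
  have := X.mem_centreIdeal.1 hf 0
  rwa [← MvPolynomial.constantCoeff_eq, constantCoeff_coaction] at this

lemma mem_centreIdeal_of_mem_zero {f : X.alg U} (hf : f ∈ X.gr U 0) (hI : f ∈ X.singIdeal U) :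
    f ∈ X.centreIdeal U := by
  obtain ⟨a, rfl⟩ := X.mem_gr_zero.1 hf
  rw [centreIdeal, RingHom.mem_ker, RingHom.comp_apply, coaction_app, MvPolynomial.map_C,
    Ideal.Quotient.eq_zero_iff_mem.2 hI, map_zero]

lemma mem_centreIdeal_of_vectorField_mem (hw : 0 < w) {f : X.alg U} (hf : f ∈ X.gr U w)
    (h : ∀ i, X.vectorField U i f ∈ X.centreIdeal U) : f ∈ X.centreIdeal U := by
  rw [mem_centreIdeal]
  intro α
  -- As `f` has weight `w`, its co-action has degree at most `1` in `u`.
  obtain hα | hα | hα : α.degree = 0 ∨ α.degree = 1 ∨ 1 < α.degree := by lia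
  · rw [(Finsupp.degree_eq_zero_iff α).1 hα, ← MvPolynomial.constantCoeff_eq,
      constantCoeff_coaction]
    exact X.posIdeal_le_singIdeal U (X.mem_posIdeal hw hf)
  · obtain ⟨i, rfl⟩ := exists_eq_single_of_degree_eq_one hα
    rw [← vectorField_apply]
    exact X.centreIdeal_le_singIdeal U (h i)
  · rw [X.coeff_coaction_eq_zero hf α (by nlinarith)]
    exact zero_mem _

lemma minors_subset_centreIdeal (U : X.S.left.affineOpens) :
    X.minors U (r - X.d) ⊆ X.centreIdeal U := fun _ hδ ↦
  X.mem_centreIdeal_of_mem_zero (X.minors_subset_gr_zero _ hδ)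
    (le_sup_left (a := X.fit U X.d) (X.minors_subset_fit X.d hδ))

lemma proj_zero_mem_span_minors_of_mem_fit {d : ℕ} {f : X.alg U} (hf : f ∈ X.fit U d) :
    GradedRing.proj (X.gr U) 0 f ∈ Ideal.span (X.minors U (r - d)) := by
  suffices h : X.fit U d ≤
      (Ideal.span (X.minors U (r - d))).comap (GradedRing.projZeroRingHom (X.gr U)) from h hf
  rw [fit, fittingIdeal, Ideal.span_le]
  rintro _ ⟨v, s, rfl⟩
  have hv (i) : ∃ ω, X.conormalMap U ω = (v i).1 := by simpa using (v i).2
  choose ω hω using hv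
  choose h hh e using fun i ↦ X.exists_vectorField_eq_proj_zero (ω i)
  rw [SetLike.mem_coe, Ideal.mem_comap]
  refine Ideal.subset_span ⟨h, s, hh, ?_⟩
  rw [RingHom.map_det]
  congr 1
  ext i j
  simp only [RingHom.mapMatrix_apply, Matrix.map_apply, Matrix.of_apply, ← hω, ← e]
  rfl

lemma proj_zero_mem_span_minors {f : X.alg U} (hf : f ∈ X.centreIdeal U) :
    GradedRing.proj (X.gr U) 0 f ∈ Ideal.span (X.minors U (r - X.d)) := by
  obtain ⟨a, ha, b, hb, rfl⟩ := Submodule.mem_sup.1 (X.centreIdeal_le_singIdeal U hf)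
  rw [map_add, X.mem_posIdeal_iff.1 hb, add_zero]
  exact X.proj_zero_mem_span_minors_of_mem_fit ha

end Cone

/-! ### Functions at rational points -/

section Points

variable {k : Type u} [Field k] {Y : SchOver k} (z : KPoint Y) {V : Y.left.Opens}

/-- The value of functions on `V` at a `k`-rational point of `V`. -/
def evalAt (h : ⊤ ≤ z.left ⁻¹ᵁ V) : Γ(Y.left, V) →+* k :=
  (z.left.appLE V ⊤ h ≫ (Scheme.ΓSpecIso (.of k)).hom).hom

variable {z}

lemma specFun_evalAt (h : ⊤ ≤ z.left ⁻¹ᵁ V) (f : Γ(Y.left, V)) :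
    specFun (R := .of k) (evalAt z h f) = (z.left.appLE V ⊤ h).hom f :=
  congr($((Scheme.ΓSpecIso (.of k)).hom_inv_id).hom _)

lemma evalAt_eq_zero_iff (h : ⊤ ≤ z.left ⁻¹ᵁ V) (f : Γ(Y.left, V)) :
    evalAt z h f = 0 ↔ (z.left.appLE V ⊤ h).hom f = 0 := by
  rw [← specFun_evalAt, map_eq_zero_iff _ (specFun_injective (.of k))]

lemma evalAt_comp {Y' : SchOver k} (p : Y ⟶ Y') {U : Y'.left.Opens} (h : ⊤ ≤ z.left ⁻¹ᵁ V)
    (hp : V ≤ p.left ⁻¹ᵁ U) (h' : ⊤ ≤ (z ≫ p).left ⁻¹ᵁ U) (f : Γ(Y'.left, U)) :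
    evalAt (z ≫ p) h' f = evalAt z h ((p.left.appLE U V hp).hom f) :=
  congr((Scheme.ΓSpecIso (.of k)).hom.hom $(appLE_comp_apply z.left p.left h hp h' f))

lemma top_le_of_pos_mem (h : z.pos ∈ V) : ⊤ ≤ z.left ⁻¹ᵁ V := by
  intro p _
  obtain rfl : p = IsLocalRing.closedPoint k := Subsingleton.elim (α := PrimeSpectrum k) _ _
  exact h

lemma mem_basicOpen_iff_evalAt_ne_zero (h : ⊤ ≤ z.left ⁻¹ᵁ V) (f : Γ(Y.left, V)) :
    z.pos ∈ Y.left.basicOpen f ↔ evalAt z h f ≠ 0 := by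
  have h1 := Scheme.basicOpen_appLE z.left ⊤ V h f
  rw [← specFun_evalAt] at h1
  constructor
  · intro hz h0
    have h2 : IsLocalRing.closedPoint k ∈ ⊤ ⊓ z.left ⁻¹ᵁ Y.left.basicOpen f := ⟨trivial, hz⟩
    rw [← h1, h0, map_zero, Scheme.basicOpen_zero] at h2
    exact h2
  · intro hne
    rw [Scheme.basicOpen_of_isUnit _ ((isUnit_iff_ne_zero.2 hne).map _)] at h1
    exact (h1.le (Set.mem_univ (IsLocalRing.closedPoint k))).2

lemma top_le_toPt_comp (h : ⊤ ≤ z.left ⁻¹ᵁ V) (T : SchOver k) : ⊤ ≤ (toPt T ≫ z).left ⁻¹ᵁ V :=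
  fun p _ ↦ h (Set.mem_univ ((toPt T).left p))

lemma toPt_comp_appLE (h : ⊤ ≤ z.left ⁻¹ᵁ V) (R : Type u) [CommRing R] [Algebra k R] :
    ((toPt (specOver k R) ≫ z).left.appLE V ⊤ (top_le_toPt_comp h _)).hom =
      (specFun (R := .of R)).comp ((algebraMap k R).comp (evalAt z h)) := by
  ext f
  refine (appLE_comp_apply (toPt (specOver k R)).left z.left (V := ⊤) le_rfl h
    (top_le_toPt_comp h _) f).trans ?_
  rw [← specFun_evalAt]
  refine congr($(appLE_top (toPt (specOver k R)).left le_rfl).hom _).trans ?_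
  exact congr($(Scheme.ΓSpecIso_inv_naturality (CommRingCat.ofHom (algebraMap k R))).hom _).symm

end Points

namespace Cone

variable {k : Type u} [Field k] {r w : ℕ} (X : Cone k r w) {z : KPoint X.C}
  {U : X.S.left.affineOpens}

lemma exists_affineOpen (z : KPoint X.C) :
    ∃ U : X.S.left.affineOpens, ⊤ ≤ z.left ⁻¹ᵁ (X.π.left ⁻¹ᵁ U) := by
  obtain ⟨U, hU, hz, -⟩ := exists_isAffineOpen_mem_and_subset
    (x := X.π.left z.pos) (U := ⊤) trivial
  exact ⟨⟨U, hU⟩, top_le_of_pos_mem hz⟩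

section Chart

variable (h : ⊤ ≤ z.left ⁻¹ᵁ (X.π.left ⁻¹ᵁ U))

/-! ### Stabilisers and gradients -/

/-- The vector `(ξ₁.f(z), …, ξ_r.f(z))`, the differential at `u = 0` of `u ↦ f(u.z)`. -/
def gradient (f : X.alg U) : Fin r → k :=
  fun i ↦ evalAt z h (X.vectorField U i f)

lemma ga_inr_appLE (ξ : Fin r → k) (f : X.alg U) :
    ((X.ga.act (fun i ↦ specFun (R := .of (DualNumber k)) (TrivSqZeroExt.inr (ξ i)))
      (toPt (specOver k (DualNumber k)) ≫ z)).left.appLE _ ⊤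
        (X.top_le_ga (top_le_toPt_comp h _) _)).hom f =
      specFun (R := .of (DualNumber k)) (TrivSqZeroExt.inl (evalAt z h f) +
        TrivSqZeroExt.inr (X.gradient h f ⬝ᵥ ξ)) := by
  rw [X.ga_appLE (top_le_toPt_comp h _), toPt_comp_appLE h]
  refine (MvPolynomial.eval₂_comp_left (specFun (R := .of (DualNumber k)))
    ((algebraMap k (DualNumber k)).comp (evalAt z h))
    (fun i ↦ TrivSqZeroExt.inr (ξ i)) (X.coaction U f)).symm.trans ?_
  rw [eval₂_inr, ← MvPolynomial.constantCoeff_eq, constantCoeff_coaction]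
  simp only [← vectorField_apply, dotProduct, gradient, mul_comm]

lemma lieStab_eq_orthogonal :
    X.ga.lieStab z =
      LinearMap.BilinForm.orthogonal (dotProductBilin k k)
        (Submodule.span k (Set.range (X.gradient h))) := by
  ext ξ
  have hz (f : X.alg U) := congr($(toPt_comp_appLE h (DualNumber k)) f)
  rw [mem_orthogonal_span_dotProductBilin, Set.forall_mem_range]
  change X.ga.act _ (toPt (specOver k (DualNumber k)) ≫ z) = toPt _ ≫ z ↔ _
  constructor
  · intro hξ f
    have h1 := appLE_congr_hom congr($(hξ).left) (X.top_le_ga (top_le_toPt_comp h _) _)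
      (top_le_toPt_comp h _) f
    rw [X.ga_inr_appLE h ξ f] at h1
    simpa [TrivSqZeroExt.algebraMap_eq_inl] using congr_arg TrivSqZeroExt.snd
      (specFun_injective (.of (DualNumber k)) (h1.trans (hz f)))
  · intro hξ
    ext1
    refine hom_ext_of_appLE (X.isAffineOpen_preimage U) (X.top_le_ga (top_le_toPt_comp h _) _)
      (top_le_toPt_comp h _) fun f ↦ ?_
    rw [X.ga_inr_appLE h ξ f, hξ f, hz]
    simp [TrivSqZeroExt.algebraMap_eq_inl]

/-! ### The zero section -/

lemma gm_unitT_appLE_eq_iff {n : ℕ} (hn : 0 < n) {f : X.alg U} (hf : f ∈ X.gr U n) :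
    ((X.gm.act (unitT k) (toPt _ ≫ z)).left.appLE _ ⊤
        (X.top_le_gm (top_le_toPt_comp h _) _)).hom f =
      ((toPt _ ≫ z).left.appLE _ ⊤ (top_le_toPt_comp h _)).hom f ↔ evalAt z h f = 0 := by
  have hT : ((unitT k : (Γ((specOver k (LaurentPolynomial k)).left, ⊤))ˣ) :
      Γ((specOver k (LaurentPolynomial k)).left, ⊤)) ^ n =
      specFun (R := .of (LaurentPolynomial k)) (LaurentPolynomial.T (n : ℤ)) := by
    rw [← mul_one (n : ℤ), ← LaurentPolynomial.T_pow, map_pow]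
    rfl
  have hz : ((toPt _ ≫ z).left.appLE _ ⊤ (top_le_toPt_comp h _)).hom f =
      specFun (R := .of (LaurentPolynomial k)) (LaurentPolynomial.C (evalAt z h f)) :=
    congr($(toPt_comp_appLE h (LaurentPolynomial k)) f)
  rw [X.gm_appLE_of_mem (top_le_toPt_comp h _) _ hf, hT, hz, ← map_mul,
    (specFun_injective (.of (LaurentPolynomial k))).eq_iff]
  constructor
  · intro h1
    have h2 := congr(($h1).coeff 0)
    rw [mul_comm, coeff_C_mul_T, if_neg (mod_cast hn.ne'),
      ← mul_one (LaurentPolynomial.C _), ← LaurentPolynomial.T_zero, coeff_C_mul_T,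
      if_pos rfl] at h2
    exact h2.symm
  · intro h0
    rw [h0, map_zero, mul_zero]

lemma gm_unitT_eq_iff :
    X.gm.act (unitT k) (toPt _ ≫ z) = toPt _ ≫ z ↔ ∀ f ∈ X.posIdeal U, evalAt z h f = 0 := by
  constructor
  · intro hz
    suffices X.posIdeal U ≤ RingHom.ker (evalAt z h) from this
    rw [posIdeal, Ideal.span_le]
    rintro f ⟨n, hn, hf⟩
    exact (X.gm_unitT_appLE_eq_iff h hn hf).1 (appLE_congr_hom congr($(hz).left) _ _ f)
  · intro hz
    ext1
    refine hom_ext_of_appLE (X.isAffineOpen_preimage U) (X.top_le_gm (top_le_toPt_comp h _) _)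
      (top_le_toPt_comp h _) fun f ↦ ?_
    induction f using DirectSum.Decomposition.inductionOn (X.gr U) with
    | zero => simp only [map_zero]
    | add a b ha hb => simp only [map_add, ha, hb]
    | @homogeneous n a =>
      rcases n.eq_zero_or_pos with rfl | hn
      · rw [X.gm_appLE_of_mem (top_le_toPt_comp h _) _ a.2, pow_zero, one_mul]
      · exact (X.gm_unitT_appLE_eq_iff h hn a.2).2 (hz a (X.mem_posIdeal hn a.2))

lemma mem_zeroSection_iff : z ∈ X.zeroSection ↔ ∀ f ∈ X.posIdeal U, evalAt z h f = 0 := by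
  constructor
  · exact fun hz f hf ↦ (evalAt_eq_zero_iff h f).2 (hz U h f hf)
  -- Being fixed by `𝔾ₘ` does not refer to the chart `U`.
  · intro hz U' h' f hf
    exact (evalAt_eq_zero_iff h' f).1
      ((X.gm_unitT_eq_iff h').1 ((X.gm_unitT_eq_iff h).2 hz) f hf)

lemma evalAt_proj_zero (hz : z ∈ X.zeroSection) (f : X.alg U) :
    evalAt z h (GradedRing.proj (X.gr U) 0 f) = evalAt z h f := by
  have := (X.mem_zeroSection_iff h).1 hz _ (X.sub_proj_zero_mem_posIdeal f)
  rw [map_sub, sub_eq_zero] at this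
  exact this.symm

lemma evalAt_app (h' : ⊤ ≤ (z ≫ X.π).left ⁻¹ᵁ U) (a : Γ(X.S.left, U)) :
    evalAt z h ((X.π.left.app U).hom a) = evalAt (z ≫ X.π) h' a := by
  rw [evalAt_comp X.π h le_rfl h', Scheme.Hom.app_eq_appLE]

lemma exists_app_eq_proj_zero (U : X.S.left.affineOpens) :
    ∃ ρ : X.alg U →+* Γ(X.S.left, U),
      ∀ f, (X.π.left.app U).hom (ρ f) = GradedRing.proj (X.gr U) 0 f := by
  choose ρ hρ using fun f ↦ X.mem_gr_zero.1 (proj_mem (X.gr U) 0 f)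
  refine ⟨⟨⟨⟨ρ, ?_⟩, ?_⟩, ?_, ?_⟩, hρ⟩
  · exact X.app_injective U ((hρ 1).trans
      ((proj_of_mem _ SetLike.GradedOne.one_mem).trans (map_one _).symm))
  · exact fun a b ↦ X.app_injective U (by simp only [hρ, map_mul, proj_zero_mul])
  · exact X.app_injective U (by simp only [hρ, map_zero])
  · exact fun a b ↦ X.app_injective U (by simp only [hρ, map_add])

end Chart

lemma exists_zeroSection_lift (y : KPoint X.S) : ∃ z ∈ X.zeroSection, z ≫ X.π = y := by
  obtain ⟨W, hW, hyW, -⟩ := exists_isAffineOpen_mem_and_subset (x := y.pos) (U := ⊤) trivial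
  obtain ⟨U, hy⟩ : ∃ U : X.S.left.affineOpens, ⊤ ≤ y.left ⁻¹ᵁ U :=
    ⟨⟨W, hW⟩, top_le_of_pos_mem hyW⟩
  have hV := X.isAffineOpen_preimage U
  obtain ⟨ρ, hρ⟩ := X.exists_app_eq_proj_zero U
  have hρapp (a) : ρ ((X.π.left.app U).hom a) = a :=
    X.app_injective U (by rw [hρ, proj_of_mem _ (X.mem_gr_zero.2 ⟨a, rfl⟩)])
  let ψ : X.alg U ⟶ .of k := CommRingCat.ofHom ((evalAt y hy).comp ρ)
  let ζ : Spec (.of k) ⟶ X.C.left := Spec.map ψ ≫ hV.fromSpec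
  have hζ : ⊤ ≤ ζ ⁻¹ᵁ (X.π.left ⁻¹ᵁ U) := top_le_specMap_fromSpec hV ψ
  have hζapp (f) : (ζ.appLE _ ⊤ hζ).hom f = specFun (R := .of k) (evalAt y hy (ρ f)) :=
    congr($(specMap_fromSpec_appLE hV ψ hζ).hom f)
  have hζπ : ζ ≫ X.π.left = y.left := by
    refine hom_ext_of_appLE U.2 hζ hy fun a ↦ ?_
    rw [appLE_comp_apply ζ X.π.left hζ le_rfl hζ, hζapp, Scheme.Hom.appLE_eq_app, hρapp,
      specFun_evalAt hy a]
  let z : KPoint X.C :=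
    Over.homMk ζ (by rw [← Over.w X.π, ← Category.assoc, hζπ]; exact Over.w y)
  refine ⟨z, (X.mem_zeroSection_iff (z := z) hζ).2 fun f hf ↦ ?_, ?_⟩
  · refine (evalAt_eq_zero_iff (z := z) hζ f).2 ((hζapp f).trans ?_)
    have hρf : ρ f = 0 := X.app_injective U (by rw [hρ, X.mem_posIdeal_iff.1 hf, map_zero])
    rw [hρf, map_zero, map_zero]
  · ext1
    exact hζπ

lemma exists_zeroSection_mem [IsAlgClosed k] {W : X.S.left.Opens}
    (hW : (W : Set X.S.left).Nonempty) : ∃ z ∈ X.zeroSection, X.π.left z.pos ∈ W := by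
  have := X.isVariety_S.locallyOfFiniteType
  have : JacobsonSpace X.S.left := LocallyOfFiniteType.jacobsonSpace X.S.hom
  obtain ⟨y, hyW, hy⟩ := nonempty_inter_closedPoints hW W.2.isLocallyClosed
  obtain ⟨z, hz, hzy⟩ := X.exists_zeroSection_lift
    (Over.homMk (pointOfClosedPoint X.S.hom y hy) (pointOfClosedPoint_comp X.S.hom y hy))
  refine ⟨z, hz, ?_⟩
  have hπz : X.π.left z.pos = y :=
    congr(KPoint.pos $hzy).trans (pointOfClosedPoint_apply X.S.hom y hy _)
  rwa [hπz]

lemma zeroSection_nonempty [IsAlgClosed k] : X.zeroSection.Nonempty := by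
  have := X.isVariety_S.isIntegral
  obtain ⟨z, hz, -⟩ := X.exists_zeroSection_mem (W := ⊤) Set.univ_nonempty
  exact ⟨z, hz⟩

/-! ### Dimensions of stabilisers -/

lemma dimStab_le (z : KPoint X.C) : X.dimStab z ≤ r := by
  simpa [dimStab] using Submodule.finrank_le (X.ga.lieStab z)

lemma d_le_dimStab (hz : z ∈ X.zeroSection) : X.d ≤ X.dimStab z :=
  Nat.sInf_le ⟨z, hz, rfl⟩

lemma exists_dimStab_eq_d [IsAlgClosed k] : ∃ z ∈ X.zeroSection, X.dimStab z = X.d :=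
  Nat.sInf_mem (X.zeroSection_nonempty.image X.dimStab)

section Chart

variable (h : ⊤ ≤ z.left ⁻¹ᵁ (X.π.left ⁻¹ᵁ U)) {n : ℕ}

lemma dimStab_add_le_iff :
    X.dimStab z + n ≤ r ↔
      ∃ (c : Fin n → X.alg U) (s : Fin n → Fin r), evalAt z h (X.jacobian c s).det ≠ 0 := by
  have hle := (Submodule.span k (Set.range (X.gradient h))).finrank_le
  rw [Module.finrank_fin_fun] at hle
  have hiff {m : ℕ} (hm : m ≤ r) : r - m + n ≤ r ↔ n ≤ m := by lia
  rw [dimStab, X.lieStab_eq_orthogonal h, finrank_orthogonal_dotProductBilin, Fintype.card_fin,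
    hiff hle, le_finrank_span_iff_exists_det_ne_zero]
  simp only [Set.mem_range, RingHom.map_det]
  constructor
  · rintro ⟨v, hv, s, hs⟩
    choose c hc using hv
    obtain rfl : (fun i ↦ X.gradient h (c i)) = v := funext hc
    exact ⟨c, s, hs⟩
  · rintro ⟨c, s, hs⟩
    exact ⟨fun i ↦ X.gradient h (c i), fun i ↦ ⟨c i, rfl⟩, s, hs⟩

lemma dimStab_add_le_iff_exists_minors (hz : z ∈ X.zeroSection) :
    X.dimStab z + n ≤ r ↔ ∃ δ ∈ X.minors U n, evalAt z h δ ≠ 0 := by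
  constructor
  · intro hn
    obtain ⟨c, s, hs⟩ := (X.dimStab_add_le_iff h).1 hn
    refine ⟨_, ⟨fun i ↦ GradedRing.proj (X.gr U) w (c i), s, fun i ↦ proj_mem _ _ _, rfl⟩, ?_⟩
    have heq : (evalAt z h).mapMatrix (X.jacobian (fun i ↦ GradedRing.proj (X.gr U) w (c i)) s) =
        (evalAt z h).mapMatrix (X.jacobian c s) := by
      ext i j
      change evalAt z h (X.vectorField U (s j) _) = evalAt z h (X.vectorField U (s j) _)
      rw [← proj_zero_vectorField, X.evalAt_proj_zero h hz]
    rwa [RingHom.map_det, heq, ← RingHom.map_det]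
  · rintro ⟨_, ⟨c, s, -, rfl⟩, hne⟩
    exact (X.dimStab_add_le_iff h).2 ⟨c, s, hne⟩

end Chart

lemma mem_basicOpen_iff (h : ⊤ ≤ z.left ⁻¹ᵁ (X.π.left ⁻¹ᵁ U)) (a : Γ(X.S.left, U)) :
    X.π.left z.pos ∈ X.S.left.basicOpen a ↔ evalAt z h ((X.π.left.app U).hom a) ≠ 0 := by
  rw [X.evalAt_app h h]
  exact mem_basicOpen_iff_evalAt_ne_zero (z := z ≫ X.π) h a

lemma exists_zeroSection_mem_dimStab_le [IsAlgClosed k] (hz : z ∈ X.zeroSection)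
    {W : X.S.left.Opens} (hW : (W : Set X.S.left).Nonempty) :
    ∃ z₁ ∈ X.zeroSection, X.π.left z₁.pos ∈ W ∧ X.dimStab z₁ ≤ X.dimStab z := by
  have := X.isVariety_S.isIntegral
  obtain ⟨U, h⟩ := X.exists_affineOpen z
  obtain ⟨δ, hδ, hne⟩ := (X.dimStab_add_le_iff_exists_minors h hz).1
    (Nat.add_sub_of_le (X.dimStab_le z)).le
  obtain ⟨a, rfl⟩ := X.mem_gr_zero.1 (X.minors_subset_gr_zero _ hδ)
  obtain ⟨z₁, hz₁, hz₁a, hz₁W⟩ := X.exists_zeroSection_mem (W := X.S.left.basicOpen a ⊓ W)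
    (nonempty_preirreducible_inter (X.S.left.basicOpen a).2 W.2
      ⟨_, (X.mem_basicOpen_iff h a).2 hne⟩ hW)
  have h₁ : ⊤ ≤ z₁.left ⁻¹ᵁ (X.π.left ⁻¹ᵁ U) := top_le_of_pos_mem (X.S.left.basicOpen_le a hz₁a)
  have := (X.dimStab_add_le_iff_exists_minors h₁ hz₁).2
    ⟨_, hδ, (X.mem_basicOpen_iff h₁ a).1 hz₁a⟩
  exact ⟨z₁, hz₁, hz₁W, by have := X.dimStab_le z; lia⟩

lemma d_le [IsAlgClosed k] : X.d ≤ r := by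
  obtain ⟨z, -, hd⟩ := X.exists_dimStab_eq_d
  exact hd ▸ X.dimStab_le z

lemma exists_minors_ne_zero [IsAlgClosed k] (hU : (U.1 : Set X.S.left).Nonempty) :
    ∃ δ ∈ X.minors U (r - X.d), δ ≠ 0 := by
  obtain ⟨z₀, hz₀, hd⟩ := X.exists_dimStab_eq_d
  obtain ⟨z, hz, hzU, hle⟩ := X.exists_zeroSection_mem_dimStab_le hz₀ hU
  have h : ⊤ ≤ z.left ⁻¹ᵁ (X.π.left ⁻¹ᵁ U) := top_le_of_pos_mem hzU
  obtain ⟨δ, hδ, hne⟩ := (X.dimStab_add_le_iff_exists_minors h hz (n := r - X.d)).1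
    (by have := X.d_le; lia)
  exact ⟨δ, hδ, ne_zero_of_map hne⟩

end Cone

/-! ### Blowing up -/

/-- The germ at `y` of the inverse image under `p` of a function on an open neighbourhood of
`p y`. -/
def pullGerm {Y C : Scheme.{u}} (p : Y ⟶ C) (y : Y) {V : C.Opens} (hy : p y ∈ V) :
    Γ(C, V) →+* Y.presheaf.stalk y :=
  (C.presheaf.germ V (p y) hy ≫ p.stalkMap y).hom

lemma germ_appLE {Y C : Scheme.{u}} (p : Y ⟶ C) {y : Y} {V : C.Opens} {W : Y.Opens}
    (h : W ≤ p ⁻¹ᵁ V) (hy : y ∈ W) (f : Γ(C, V)) :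
    (Y.presheaf.germ W y hy).hom ((p.appLE V W h).hom f) = pullGerm p y (h hy) f := by
  have : p.appLE V W h ≫ Y.presheaf.germ W y hy =
      C.presheaf.germ V (p y) (h hy) ≫ p.stalkMap y := by
    rw [Scheme.Hom.appLE, Category.assoc, TopCat.Presheaf.germ_res]
    exact (Scheme.Hom.germ_stalkMap p V y (h hy)).symm
  exact congr($(this).hom f)

lemma pullGerm_comp {Y B C : Scheme.{u}} (j : Y ⟶ B) (b : B ⟶ C) (y : Y) {V : C.Opens}
    (hy : (j ≫ b) y ∈ V) :
    pullGerm (j ≫ b) y hy = (j.stalkMap y).hom.comp (pullGerm b (j y) hy) := by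
  rw [pullGerm, Scheme.Hom.stalkMap_comp]
  rfl

lemma germ_mem_nonZeroDivisors {Y : Scheme.{u}} {V : Y.Opens} (hV : IsAffineOpen V) {y : Y}
    (hy : y ∈ V) {g : Γ(Y, V)} (hg : g ∈ nonZeroDivisors Γ(Y, V)) :
    (Y.presheaf.germ V y hy).hom g ∈ nonZeroDivisors (Y.presheaf.stalk y) := by
  let := Y.presheaf.algebra_section_stalk ⟨y, hy⟩
  have := hV.isLocalization_stalk ⟨y, hy⟩
  exact IsLocalization.map_nonZeroDivisors_le (hV.primeIdealOf ⟨y, hy⟩).asIdeal.primeCompl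
    (Y.presheaf.stalk y) (Submonoid.mem_map_of_mem (algebraMap _ _) hg)

namespace Cone

variable {k : Type u} [Field k] {r w : ℕ} {X : Cone k r w}
  {J : ∀ U : X.S.left.affineOpens, Ideal (X.alg U)} {Y B : Scheme.{u}}

lemma inverseImageInvertible_of_le {f : Y ⟶ X.C.left} {U : X.S.left.affineOpens} {a : X.alg U}
    (ha : a ∈ J U) (hf : ⊤ ≤ f ⁻¹ᵁ X.C.left.basicOpen a) : X.InverseImageInvertible J f := by
  intro y
  obtain ⟨V, hV, hyV, -⟩ := exists_isAffineOpen_mem_and_subset (x := y) (U := ⊤) trivial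
  have hVa : V ≤ f ⁻¹ᵁ X.C.left.basicOpen a := le_top.trans hf
  have hVU : V ≤ f ⁻¹ᵁ (X.π.left ⁻¹ᵁ U) := hVa.trans fun x hx ↦ X.C.left.basicOpen_le a hx
  have hunit : IsUnit ((f.appLE _ V hVU).hom a) :=
    RingedSpace.isUnit_of_isUnit_germ Y.toRingedSpace V _ fun x hx ↦
      (Scheme.mem_basicOpen _ _ x hx).1
        ((Scheme.basicOpen_appLE f V (X.π.left ⁻¹ᵁ U) hVU a).ge ⟨hx, hVa hx⟩)
  refine ⟨U, ⟨V, hV⟩, hVU, hyV, 1, one_mem _, ?_⟩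
  rw [Ideal.span_singleton_one]
  exact Ideal.eq_top_of_isUnit_mem _ (Ideal.mem_map_of_mem _ ha) hunit

lemma IsBlowup.hom_ext {b : B ⟶ X.C.left} (hb : X.IsBlowup J b) {U : X.S.left.affineOpens}
    {a : X.alg U} (ha : a ∈ J U) {g₁ g₂ : Y ⟶ B} (h : g₁ ≫ b = g₂ ≫ b)
    (hg : ⊤ ≤ (g₁ ≫ b) ⁻¹ᵁ X.C.left.basicOpen a) : g₁ = g₂ :=
  (hb.2 Y (g₁ ≫ b) (inverseImageInvertible_of_le ha hg)).unique rfl h.symm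

lemma IsBlowup.exists_section {b : B ⟶ X.C.left} (hb : X.IsBlowup J b)
    {U : X.S.left.affineOpens} {a : X.alg U} (ha : a ∈ J U) :
    ∃ g : (X.C.left.basicOpen a : Scheme.{u}) ⟶ B, g ≫ b = (X.C.left.basicOpen a).ι ∧
      ∀ (y : B) (hy : b y ∈ X.C.left.basicOpen a), g ⟨b y, hy⟩ = y := by
  let E := X.C.left.basicOpen a
  obtain ⟨g, hg, -⟩ := hb.2 E E.ι (inverseImageInvertible_of_le ha (by simp [E]))
  refine ⟨g, hg, fun y hy ↦ ?_⟩
  let l : (b ⁻¹ᵁ E : Scheme.{u}) ⟶ E := b.resLE E (b ⁻¹ᵁ E) le_rfl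
  have hlb : (l ≫ g) ≫ b = (b ⁻¹ᵁ E).ι ≫ b := by
    rw [Category.assoc, hg]
    exact Scheme.Hom.resLE_comp_ι _ _
  have hl : l ≫ g = (b ⁻¹ᵁ E).ι := hb.hom_ext ha hlb fun x _ ↦ by
    rw [hlb]
    exact x.2
  let y' : (b ⁻¹ᵁ E : Scheme.{u}) := ⟨y, hy⟩
  have hly : l y' = ⟨b y, hy⟩ := Subtype.ext (Scheme.Hom.coe_resLE_apply b le_rfl y')
  exact (congr_arg g hly.symm).trans congr($hl y')

lemma InverseImageInvertible.exists_map_pullGerm_eq {f : Y ⟶ X.C.left}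
    (hf : X.InverseImageInvertible J f) (y : Y) :
    ∃ (U : X.S.left.affineOpens) (hy : f y ∈ X.π.left ⁻¹ᵁ U.1),
      ∃ g ∈ nonZeroDivisors (Y.presheaf.stalk y),
        (J U).map (pullGerm f y hy) = Ideal.span {g} := by
  obtain ⟨U, V, h, hyV, g, hg, hJ⟩ := hf y
  refine ⟨U, h hyV, _, germ_mem_nonZeroDivisors V.2 hyV hg, ?_⟩
  have hgerm : pullGerm f y (h hyV) =
      (Y.presheaf.germ V.1 y hyV).hom.comp (f.appLE _ V h).hom :=
    RingHom.ext fun a ↦ (germ_appLE f h hyV a).symm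
  rw [hgerm, ← Ideal.map_map, hJ, Ideal.map_span, Set.image_singleton]

lemma InverseImageInvertible.exists_mem_basicOpen {f : Y ⟶ X.C.left}
    (hf : X.InverseImageInvertible J f) {N : Y.Opens} (hN : (N : Set Y).Nonempty) :
    ∃ (U : X.S.left.affineOpens) (a : X.alg U), a ∈ J U ∧
      ∃ y ∈ N, f y ∈ X.C.left.basicOpen a := by
  obtain ⟨y, hyN⟩ := hN
  obtain ⟨U, hy, g, hg, hJ⟩ := hf.exists_map_pullGerm_eq y
  by_contra! hcon
  obtain ⟨V, hV, hyV, hVle⟩ := exists_isAffineOpen_mem_and_subset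
    (x := y) (U := N ⊓ f ⁻¹ᵁ (X.π.left ⁻¹ᵁ U.1)) ⟨hyN, hy⟩
  have hVU : V ≤ f ⁻¹ᵁ (X.π.left ⁻¹ᵁ U.1) := fun x hx ↦ (hVle hx).2
  have hnil : (J U).map (pullGerm f y hy) ≤ nilradical (Y.presheaf.stalk y) := by
    rw [Ideal.map_le_iff_le_comap]
    intro a ha
    rw [Ideal.mem_comap, mem_nilradical, ← germ_appLE f hVU hyV]
    refine IsNilpotent.map ((Scheme.isNilpotent_iff_basicOpen_eq_bot_of_isCompact
      hV.isCompact _).2 ?_) _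
    rw [Scheme.basicOpen_appLE, eq_bot_iff]
    exact fun x hx ↦ hcon U a ha x (hVle hx.1).1 hx.2
  obtain ⟨n, hn⟩ := hnil (hJ ▸ Ideal.mem_span_singleton_self g)
  exact nonZeroDivisors.ne_zero (pow_mem hg n) hn

lemma IsBlowup.exists_mem_of_nonempty {b : B ⟶ X.C.left} (hb : X.IsBlowup J b) {N : B.Opens}
    (hN : (N : Set B).Nonempty) {W : X.C.left.Opens} (hW : (W : Set X.C.left).Nonempty) :
    ∃ x ∈ N, b x ∈ W := by
  have := X.isVariety_C.isIntegral
  obtain ⟨U, a, ha, y, hyN, hya⟩ := hb.1.exists_mem_basicOpen hN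
  let E := X.C.left.basicOpen a
  obtain ⟨g, hgb, hg⟩ := hb.exists_section ha
  have hne : (E.ι ''ᵁ (g ⁻¹ᵁ N) : Set X.C.left).Nonempty := by
    refine ⟨_, ⟨b y, hya⟩, ?_, rfl⟩
    change g _ ∈ N
    rwa [hg]
  obtain ⟨_, ⟨o, ho, rfl⟩, hoW⟩ :=
    nonempty_preirreducible_inter (E.ι ''ᵁ (g ⁻¹ᵁ N)).2 W.2 hne hW
  refine ⟨g o, ho, ?_⟩
  rwa [← Scheme.Hom.comp_apply, hgb]

lemma IsBlowup.appLE_comp_ne_zero {b : B ⟶ X.C.left} (hb : X.IsBlowup J b) (j : Y ⟶ B)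
    [IsOpenImmersion j] {V : X.C.left.Opens} {N : Y.Opens} (h : N ≤ (j ≫ b) ⁻¹ᵁ V)
    (hN : (N : Set Y).Nonempty) {a : Γ(X.C.left, V)} (ha : a ≠ 0) :
    ((j ≫ b).appLE V N h).hom a ≠ 0 := by
  have := X.isVariety_C.isIntegral
  intro h0
  have hne : (X.C.left.basicOpen a : Set X.C.left).Nonempty := by
    rw [← Opens.ne_bot_iff_nonempty, Ne, basicOpen_eq_bot_iff]
    exact ha
  obtain ⟨_, ⟨x, hx, rfl⟩, hxa⟩ :=
    hb.exists_mem_of_nonempty (N := j ''ᵁ N) (hN.image j) hne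
  have hbot := Scheme.basicOpen_appLE (j ≫ b) N V h a
  rw [h0, Scheme.basicOpen_zero] at hbot
  exact hbot.ge ⟨hx, hxa⟩

end Cone

namespace Cone

variable {k : Type u} [Field k] {r w : ℕ} {X X' : Cone k r w}

/-! ### Equivariant morphisms -/

/-- Equivariance of a morphism of cones for the actions of `𝔾ₐʳ` and `𝔾ₘ`, on `T`-points. -/
structure IsEquivariant (p : X'.C ⟶ X.C) : Prop where
  ga_act {T : SchOver k} (u : Fin r → Γ(T.left, ⊤)) (x : T ⟶ X'.C) :
    X'.ga.act u x ≫ p = X.ga.act u (x ≫ p)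
  gm_act {T : SchOver k} (t : (Γ(T.left, ⊤))ˣ) (x : T ⟶ X'.C) :
    X'.gm.act t x ≫ p = X.gm.act t (x ≫ p)

namespace IsEquivariant

variable {p : X'.C ⟶ X.C} (hp : IsEquivariant p)
include hp

lemma comp_mem_zeroSection {z : KPoint X'.C} (hz : z ∈ X'.zeroSection) :
    z ≫ p ∈ X.zeroSection := by
  obtain ⟨U', h'⟩ := X'.exists_affineOpen z
  obtain ⟨U, h⟩ := X.exists_affineOpen (z ≫ p)
  have hfix := (X'.gm_unitT_eq_iff h').2 ((X'.mem_zeroSection_iff h').1 hz)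
  rw [X.mem_zeroSection_iff h, ← X.gm_unitT_eq_iff h, ← Category.assoc, ← hp.gm_act, hfix]

variable {U : X.S.left.affineOpens} {U' : X'.S.left.affineOpens}
  (hU : X'.π.left ⁻¹ᵁ U'.1 ≤ p.left ⁻¹ᵁ (X.π.left ⁻¹ᵁ U.1))

lemma appLE_mem_gr {n : ℕ} {f : X.alg U} (hf : f ∈ X.gr U n) :
    (p.left.appLE _ _ hU).hom f ∈ X'.gr U' n := by
  intro T t x h h'
  have hxp : ⊤ ≤ (x ≫ p).left ⁻¹ᵁ (X.π.left ⁻¹ᵁ U) := fun q hq ↦ hU (h hq)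
  have hact := appLE_congr_hom congr($(hp.gm_act t x).left) (fun q hq ↦ hU (h' hq))
    (X.top_le_gm hxp t) f
  rw [X.gm_appLE_of_mem hxp t hf] at hact
  refine (appLE_comp_apply _ p.left h' hU _ f).symm.trans (hact.trans ?_)
  exact congr_arg _ (appLE_comp_apply x.left p.left h hU hxp f)

lemma proj_appLE (n : ℕ) (f : X.alg U) :
    GradedRing.proj (X'.gr U') n ((p.left.appLE _ _ hU).hom f) =
      (p.left.appLE _ _ hU).hom (GradedRing.proj (X.gr U) n f) := by
  induction f using DirectSum.Decomposition.inductionOn (X.gr U) with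
  | zero => simp only [map_zero]
  | add a b ha hb => simp only [map_add, ha, hb]
  | @homogeneous m a =>
    obtain rfl | hm := eq_or_ne m n
    · rw [proj_of_mem _ a.2, proj_of_mem _ (hp.appLE_mem_gr hU a.2)]
    · rw [proj_of_mem_of_ne _ a.2 hm, proj_of_mem_of_ne _ (hp.appLE_mem_gr hU a.2) hm, map_zero]

lemma coaction_appLE (f : X.alg U) :
    X'.coaction U' ((p.left.appLE _ _ hU).hom f) =
      MvPolynomial.map (p.left.appLE _ _ hU).hom (X.coaction U f) := by
  let P := MvPolynomial (Fin r) (X'.alg U')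
  let x := X'.affPoint U' (MvPolynomial.C : X'.alg U' →+* P)
  let v : Fin r → Γ((X'.affOver U' (MvPolynomial.C : X'.alg U' →+* P)).left, ⊤) :=
    fun i ↦ specFun (R := .of P) (MvPolynomial.X i)
  have hx : ⊤ ≤ x.left ⁻¹ᵁ (X'.π.left ⁻¹ᵁ U') := X'.top_le_affPoint _
  have hxp : ⊤ ≤ (x ≫ p).left ⁻¹ᵁ (X.π.left ⁻¹ᵁ U) := fun q hq ↦ hU (hx hq)
  have hxapp : (x.left.appLE _ ⊤ hx).hom = (specFun (R := .of P)).comp MvPolynomial.C :=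
    X'.affPoint_appLE _
  have hxpapp : ((x ≫ p).left.appLE _ ⊤ hxp).hom =
      (specFun (R := .of P)).comp (MvPolynomial.C.comp (p.left.appLE _ _ hU).hom) := by
    ext g
    exact (appLE_comp_apply x.left p.left hx hU hxp g).trans congr($hxapp _)
  have hact := (appLE_comp_apply _ p.left (X'.top_le_ga hx v) hU _ f).symm.trans
    (appLE_congr_hom congr($(hp.ga_act v x).left)
      (fun q hq ↦ hU (X'.top_le_ga hx v hq)) (X.top_le_ga hxp v) f)
  have heval {R : Type u} [CommRing R] (χ : R →+* P) (q : MvPolynomial (Fin r) R) :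
      MvPolynomial.eval₂ ((specFun (R := .of P)).comp χ) v q =
        specFun (R := .of P) (MvPolynomial.eval₂ χ MvPolynomial.X q) :=
    (MvPolynomial.eval₂_comp_left _ χ MvPolynomial.X q).symm
  rw [X.ga_appLE hxp, X'.ga_appLE hx, hxapp, hxpapp, heval, heval] at hact
  calc X'.coaction U' ((p.left.appLE _ _ hU).hom f)
      = MvPolynomial.eval₂ MvPolynomial.C MvPolynomial.X
          (X'.coaction U' ((p.left.appLE _ _ hU).hom f)) := (MvPolynomial.eval₂_eta _).symm
    _ = MvPolynomial.eval₂ (MvPolynomial.C.comp (p.left.appLE _ _ hU).hom) MvPolynomial.X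
          (X.coaction U f) := specFun_injective (.of P) hact
    _ = MvPolynomial.map (p.left.appLE _ _ hU).hom (X.coaction U f) :=
      (MvPolynomial.eval₂_map _ _ _ _).symm.trans (MvPolynomial.eval₂_eta _)

lemma appLE_vectorField (i : Fin r) (f : X.alg U) :
    (p.left.appLE _ _ hU).hom (X.vectorField U i f) =
      X'.vectorField U' i ((p.left.appLE _ _ hU).hom f) := by
  rw [vectorField_apply, vectorField_apply, hp.coaction_appLE hU, MvPolynomial.coeff_map]

end IsEquivariant

end Cone

/-! ### The modification -/

section Evaluation

variable {k : Type u} [Field k] {Y : SchOver k} {z : KPoint Y} {V : Y.left.Opens}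

lemma mem_primeIdealOf_iff (hV : IsAffineOpen V) (hz : z.pos ∈ V) (f : Γ(Y.left, V)) :
    f ∈ (hV.primeIdealOf ⟨z.pos, hz⟩).asIdeal ↔ evalAt z (top_le_of_pos_mem hz) f = 0 := by
  let := Y.left.presheaf.algebra_section_stalk ⟨z.pos, hz⟩
  have := hV.isLocalization_stalk ⟨z.pos, hz⟩
  have hunit := IsLocalization.AtPrime.isUnit_to_map_iff (Y.left.presheaf.stalk z.pos)
    (hV.primeIdealOf ⟨z.pos, hz⟩).asIdeal f
  rw [← not_iff_not, ← Ne, ← mem_basicOpen_iff_evalAt_ne_zero, Scheme.mem_basicOpen _ _ z.pos hz]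
  exact hunit.symm

end Evaluation

namespace Cone

variable {k : Type u} [Field k] {r w : ℕ} {X X' : Cone k r w}

section Cramer

variable (X) {U : X.S.left.affineOpens} {n : ℕ} {h : Fin n → X.alg U} (hh : ∀ i, h i ∈ X.gr U w)
  (s : Fin n → Fin r)
include hh

lemma adjugate_mulVec_mem (a : Fin n) : ((X.jacobian h s).adjugate.mulVec h) a ∈ X.gr U w := by
  rw [Matrix.mulVec, dotProduct]
  refine AddSubgroup.sum_mem (X.gr U w) fun i _ ↦ ?_
  have hadj : (X.jacobian h s).adjugate a i ∈ X.gr U 0 :=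
    adjugate_mem_subring (S := SetLike.GradeZero.subring (X.gr U)) (X.jacobian_mem hh s) a i
  simpa only [zero_add] using SetLike.GradedMul.mul_mem hadj (hh i)

lemma vectorField_adjugate_mulVec (l : Fin r) (a : Fin n) :
    X.vectorField U l (((X.jacobian h s).adjugate.mulVec h) a) =
      (X.jacobian h (Function.update s a l)).det := by
  have hadj (i j) : X.vectorField U l ((X.jacobian h s).adjugate i j) = 0 :=
    X.vectorField_of_mem_zero l (adjugate_mem_subring
      (S := SetLike.GradeZero.subring (X.gr U)) (X.jacobian_mem hh s) i j)
  rw [derivation_adjugate_mulVec _ hadj]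
  congr 1
  ext i j
  obtain rfl | hj := eq_or_ne j a
  · simp
  · simp [hj]

lemma vectorField_adjugate_mulVec_eq_ite (a b : Fin n) :
    X.vectorField U (s b) (((X.jacobian h s).adjugate.mulVec h) a) =
      if a = b then (X.jacobian h s).det else 0 := by
  rw [X.vectorField_adjugate_mulVec hh]
  split_ifs with hab
  · rw [hab, Function.update_eq_self]
  · exact Matrix.det_zero_of_column_eq hab fun i ↦ by simp [Ne.symm hab]

end Cramer

lemma adjugate_mulVec_mem_centreIdeal (hw : 0 < w) {U : X.S.left.affineOpens}
    {h : Fin (r - X.d) → X.alg U} (hh : ∀ i, h i ∈ X.gr U w) (s : Fin (r - X.d) → Fin r)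
    (a : Fin (r - X.d)) : ((X.jacobian h s).adjugate.mulVec h) a ∈ X.centreIdeal U := by
  refine X.mem_centreIdeal_of_vectorField_mem hw (X.adjugate_mulVec_mem hh s a) fun l ↦ ?_
  rw [X.vectorField_adjugate_mulVec hh]
  exact X.minors_subset_centreIdeal U ⟨h, _, hh, rfl⟩

lemma IsBlowup.dimStab_comp_le {J : ∀ U : X.S.left.affineOpens, Ideal (X.alg U)} {B : SchOver k}
    {b : B ⟶ X.C} (hb : X.IsBlowup J b.left) (j : X'.C ⟶ B) [IsOpenImmersion j.left]
    (hp : IsEquivariant (j ≫ b)) {U : X.S.left.affineOpens} {a : X.alg U} (ha : a ∈ J U)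
    {z : KPoint X'.C} (hz : KPoint.pos (X := X.C) (z ≫ j ≫ b) ∈ X.C.left.basicOpen a) :
    X.dimStab (z ≫ j ≫ b) ≤ X'.dimStab z := by
  refine Submodule.finrank_mono fun ξ hξ ↦ ?_
  let T := specOver k (DualNumber k)
  let v : Fin r → Γ(T.left, ⊤) :=
    fun i ↦ specFun (R := .of (DualNumber k)) (TrivSqZeroExt.inr (ξ i))
  have hfix : (toPt T ≫ z) ≫ j ≫ b = X'.ga.act v (toPt T ≫ z) ≫ j ≫ b := by
    rw [hp.ga_act, Category.assoc]
    exact hξ.symm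
  have hlift : ((toPt T ≫ z) ≫ j).left = (X'.ga.act v (toPt T ≫ z) ≫ j).left := by
    refine hb.hom_ext ha ?_ ?_
    · simpa only [Over.comp_left, Category.assoc] using congr($(hfix).left)
    · have := top_le_toPt_comp (z := z ≫ j ≫ b) (top_le_of_pos_mem hz) T
      simpa only [Over.comp_left, Category.assoc] using this
  rw [Over.comp_left, Over.comp_left] at hlift
  exact Over.OverMorphism.ext ((cancel_mono j.left).1 hlift).symm

namespace IsEquivariant

variable {p : X'.C ⟶ X.C} (hp : IsEquivariant p) {U : X.S.left.affineOpens}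
  {U' : X'.S.left.affineOpens}
  (hU : X'.π.left ⁻¹ᵁ U'.1 ≤ p.left ⁻¹ᵁ (X.π.left ⁻¹ᵁ U.1))
include hp

lemma exists_minors_dvd {z : KPoint X'.C} (hz : z ∈ X'.zeroSection)
    (hzU : z.pos ∈ X'.π.left ⁻¹ᵁ U'.1) {g : X'.C.left.presheaf.stalk z.pos}
    (hg : (X.centreIdeal U).map (pullGerm p.left z.pos (hU hzU)) = Ideal.span {g})
    {δ₀ : X.alg U} (hδ₀ : δ₀ ∈ X.minors U (r - X.d))
    (hδ₀p : (p.left.appLE _ _ hU).hom δ₀ ≠ 0) :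
    ∃ δ ∈ X.minors U (r - X.d), (p.left.appLE _ _ hU).hom δ ≠ 0 ∧ ∀ a ∈ X.centreIdeal U,
      ∃ t, evalAt z (top_le_of_pos_mem hzU) t ≠ 0 ∧
        (p.left.appLE _ _ hU).hom δ ∣ t * (p.left.appLE _ _ hU).hom a := by
  have := X'.isVariety_C.isIntegral
  have : Nonempty (X'.π.left ⁻¹ᵁ U'.1) := ⟨⟨_, hzU⟩⟩
  let := X'.C.left.presheaf.algebra_section_stalk ⟨z.pos, hzU⟩
  have hV := X'.isAffineOpen_preimage U'
  have := hV.isLocalization_stalk ⟨z.pos, hzU⟩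
  let m := (hV.primeIdealOf ⟨z.pos, hzU⟩).asIdeal
  have hm (b : X'.alg U') : GradedRing.proj (X'.gr U') 0 b ∈ m ↔ b ∈ m := by
    rw [mem_primeIdealOf_iff, mem_primeIdealOf_iff, X'.evalAt_proj_zero _ hz]
  have hgerm : pullGerm p.left z.pos (hU hzU) =
      (algebraMap (X'.alg U') (X'.C.left.presheaf.stalk z.pos)).comp
        (p.left.appLE _ _ hU).hom :=
    RingHom.ext fun a ↦ (germ_appLE p.left hU hzU a).symm
  rw [hgerm] at hg
  obtain ⟨δ, hδ, hδp, hdvd⟩ := exists_dvd_of_map_eq_span_singleton (hp.proj_appLE hU 0) hm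
    (X.minors_subset_centreIdeal U) (fun a ha ↦ X.proj_zero_mem_span_minors ha)
    (X.minors_subset_centreIdeal U hδ₀) (X.minors_subset_gr_zero _ hδ₀) hδ₀p hg
  refine ⟨δ, hδ, hδp, fun a ha ↦ ?_⟩
  obtain ⟨t, ht, hta⟩ := (algebraMap_dvd_algebraMap_iff (p := m)).1 (hdvd a ha)
  exact ⟨t, (mem_primeIdealOf_iff hV hzU t).not.1 ht, hta⟩

lemma dimStab_add_le (hw : 0 < w) {z : KPoint X'.C} (hz : z ∈ X'.zeroSection)
    (hzU : z.pos ∈ X'.π.left ⁻¹ᵁ U'.1) {g : X'.C.left.presheaf.stalk z.pos}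
    (hg : (X.centreIdeal U).map (pullGerm p.left z.pos (hU hzU)) = Ideal.span {g})
    {δ₀ : X.alg U} (hδ₀ : δ₀ ∈ X.minors U (r - X.d))
    (hδ₀p : (p.left.appLE _ _ hU).hom δ₀ ≠ 0) : X'.dimStab z + (r - X.d) ≤ r := by
  have := X'.isVariety_C.isIntegral
  have : Nonempty (X'.π.left ⁻¹ᵁ U'.1) := ⟨⟨_, hzU⟩⟩
  obtain ⟨_, ⟨h, s, hh, rfl⟩, hδp, hdvd⟩ := hp.exists_minors_dvd hU hz hzU hg hδ₀ hδ₀p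
  let φ := (p.left.appLE _ _ hU).hom
  let h' := (X.jacobian h s).adjugate.mulVec h
  have hquot (a) : ∃ t, evalAt z (top_le_of_pos_mem hzU) t ≠ 0 ∧
      ∃ c, t * φ (h' a) = c * φ (X.jacobian h s).det := by
    obtain ⟨t, ht, c, hc⟩ := hdvd _ (adjugate_mulVec_mem_centreIdeal hw hh s a)
    exact ⟨t, ht, c, hc.trans (mul_comm _ _)⟩
  choose t ht c hc using hquot
  have hdiag : X'.jacobian (fun a ↦ GradedRing.proj (X'.gr U') w (c a)) s =
      Matrix.diagonal fun a ↦ GradedRing.proj (X'.gr U') 0 (t a) := by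
    ext a b
    have hab := proj_zero_mul_derivation_eq (D := X'.vectorField U' (s b))
      (fun f hf ↦ X'.vectorField_of_mem_zero _ hf)
      (hp.appLE_mem_gr hU (X.adjugate_mulVec_mem hh s a))
      (hp.appLE_mem_gr hU (X.minors_subset_gr_zero _ ⟨h, s, hh, rfl⟩)) (hc a)
    rw [← hp.appLE_vectorField hU, X.vectorField_adjugate_mulVec_eq_ite hh] at hab
    refine mul_right_cancel₀ hδp (hab.symm.trans ?_)
    rw [Matrix.diagonal_apply]
    split_ifs <;> simp
  refine (X'.dimStab_add_le_iff (top_le_of_pos_mem hzU)).2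
    ⟨fun a ↦ GradedRing.proj (X'.gr U') w (c a), s, ?_⟩
  rw [hdiag, Matrix.det_diagonal, map_prod]
  exact Finset.prod_ne_zero_iff.2 fun a _ ↦ by rw [X'.evalAt_proj_zero _ hz]; exact ht a

end IsEquivariant

lemma exists_affineOpen_le_preimage {p : X'.C ⟶ X.C} {q : X'.S ⟶ X.S}
    (hq : X'.π ≫ q = p ≫ X.π) {U : X.S.left.affineOpens} {x : X'.C.left}
    (hx : p.left x ∈ X.π.left ⁻¹ᵁ U.1) :
    ∃ U' : X'.S.left.affineOpens, x ∈ X'.π.left ⁻¹ᵁ U'.1 ∧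
      X'.π.left ⁻¹ᵁ U'.1 ≤ p.left ⁻¹ᵁ (X.π.left ⁻¹ᵁ U.1) := by
  have hpre : p.left ⁻¹ᵁ (X.π.left ⁻¹ᵁ U.1) = X'.π.left ⁻¹ᵁ (q.left ⁻¹ᵁ U.1) := by
    rw [← Scheme.Hom.comp_preimage, ← Scheme.Hom.comp_preimage, ← Over.comp_left,
      ← Over.comp_left, hq]
  have hxq : X'.π.left x ∈ q.left ⁻¹ᵁ U.1 := hpre.le hx
  obtain ⟨V, hV, hxV, hle⟩ := exists_isAffineOpen_mem_and_subset hxq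
  exact ⟨⟨V, hV⟩, hxV, hpre.symm ▸ fun y hy ↦ hle hy⟩

variable [IsAlgClosed k] {B : SchOver k} {b : B ⟶ X.C} {j : X'.C ⟶ B} [IsOpenImmersion j.left]
  {q : X'.S ⟶ X.S}

lemma IsBlowup.dimStab_le_d (hw : 0 < w) (hb : X.IsBlowup X.centreIdeal b.left)
    (hp : IsEquivariant (j ≫ b)) (hq : X'.π ≫ q = (j ≫ b) ≫ X.π) {z : KPoint X'.C}
    (hz : z ∈ X'.zeroSection) : X'.dimStab z ≤ X.d := by
  obtain ⟨U, hzU, g, -, hg⟩ := hb.1.exists_map_pullGerm_eq (j.left z.pos)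
  obtain ⟨U', hzU', hU⟩ := exists_affineOpen_le_preimage (x := z.pos) hq hzU
  obtain ⟨δ₀, hδ₀, hne⟩ := X.exists_minors_ne_zero ⟨_, hzU⟩
  have hgj : (X.centreIdeal U).map (pullGerm (j ≫ b).left z.pos hzU) =
      Ideal.span {(j.left.stalkMap z.pos).hom g} := by
    rw [← Set.image_singleton, ← Ideal.map_span, ← hg, Ideal.map_map]
    congr 1
    exact pullGerm_comp j.left b.left z.pos hzU
  have := hp.dimStab_add_le hU hw hz hzU' hgj hδ₀
    (hb.appLE_comp_ne_zero j.left hU ⟨_, hzU'⟩ hne)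
  have := X.d_le
  lia

lemma IsBlowup.d_le_dimStab (hb : X.IsBlowup X.centreIdeal b.left)
    (hp : IsEquivariant (j ≫ b)) (hq : X'.π ≫ q = (j ≫ b) ≫ X.π) {z : KPoint X'.C}
    (hz : z ∈ X'.zeroSection) : X.d ≤ X'.dimStab z := by
  have := X'.isVariety_S.isIntegral
  obtain ⟨U, hzU⟩ := X.exists_affineOpen (z ≫ j ≫ b)
  obtain ⟨U', hzU', hU⟩ := exists_affineOpen_le_preimage (x := z.pos) hq (hzU trivial)
  obtain ⟨δ, hδ, hne⟩ := X.exists_minors_ne_zero (U := U) ⟨_, hU hzU'⟩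
  obtain ⟨a, ha⟩ := X'.mem_gr_zero.1 (hp.appLE_mem_gr hU (X.minors_subset_gr_zero _ hδ))
  have hW : (X'.S.left.basicOpen a : Set X'.S.left).Nonempty := by
    rw [← Opens.ne_bot_iff_nonempty, Ne, basicOpen_eq_bot_iff]
    rintro rfl
    exact hb.appLE_comp_ne_zero j.left hU ⟨_, hzU'⟩ hne (ha.symm.trans (map_zero _))
  obtain ⟨z₁, hz₁, hz₁a, hle⟩ := X'.exists_zeroSection_mem_dimStab_le hz hW
  have h₁ : ⊤ ≤ z₁.left ⁻¹ᵁ (X'.π.left ⁻¹ᵁ U') :=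
    top_le_of_pos_mem (X'.S.left.basicOpen_le a hz₁a)
  have h₂ : ⊤ ≤ (z₁ ≫ j ≫ b).left ⁻¹ᵁ (X.π.left ⁻¹ᵁ U.1) := fun x hx ↦ hU (h₁ hx)
  have hδz₁ : KPoint.pos (X := X.C) (z₁ ≫ j ≫ b) ∈ X.C.left.basicOpen δ := by
    rw [mem_basicOpen_iff_evalAt_ne_zero (Y := X.C) h₂, evalAt_comp (j ≫ b) h₁ hU h₂, ← ha]
    exact (X'.mem_basicOpen_iff h₁ a).1 hz₁a
  calc X.d ≤ X.dimStab (z₁ ≫ j ≫ b) := X.d_le_dimStab (hp.comp_mem_zeroSection hz₁)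
    _ ≤ X'.dimStab z₁ := hb.dimStab_comp_le j hp (X.minors_subset_centreIdeal U hδ) hδz₁
    _ ≤ X'.dimStab z := hle

end Cone

end AdditiveCone

end

theorem proposition4p1_general {k : Type u} [Field k] [IsAlgClosed k] {r w : ℕ} (hw : 0 < w)
    {X X' : AdditiveCone.Cone k r w} {B : AdditiveCone.SchOver k} {b : B ⟶ X.C}
    (hb : X.IsBlowup X.centreIdeal b.left) {j : X'.C ⟶ B} [IsOpenImmersion j.left]
    (hp : AdditiveCone.Cone.IsEquivariant (j ≫ b)) {q : X'.S ⟶ X.S}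
    (hq : X'.π ≫ q = (j ≫ b) ≫ X.π) :
    (∀ z' ∈ X'.zeroSection, X'.dimStab z' = X.d) ∧ X'.d = X.d := by
  have hdim : ∀ z' ∈ X'.zeroSection, X'.dimStab z' = X.d := fun z' hz' ↦
    (hb.dimStab_le_d hw hp hq hz').antisymm (hb.d_le_dimStab hp hq hz')
  obtain ⟨z', hz', hd⟩ := X'.exists_dimStab_eq_d
  exact ⟨hdim, hd.symm.trans (hdim z' hz')⟩

theorem proposition4p1 {k : Type u} [Field k] [IsAlgClosed k] [CharZero k] (r w : ℕ)
    (hr : 0 < r) (hw : 0 < w) (X X' : AdditiveCone.Cone k r w)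
    (hX' : X.IsModification X.centreIdeal X') :
    (∀ z' ∈ X'.zeroSection, X'.dimStab z' = X.d) ∧ X'.d = X.d := by
  obtain ⟨B, b, gmB, j, q, hb, hgmB, hj, -, hgmj, hga, hq⟩ := hX'
  exact proposition4p1_general hw hb
    ⟨hga, fun t x ↦ by rw [← Category.assoc, hgmj, hgmB, Category.assoc]⟩ hq
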